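/- A \emph{graph} has a set of vertices, a set of edges, a start map $s$ from edges to vertices and a fixed-point-free involution $e\mapsto e^{-1}$ on the edges. For $n\ge 0$ the standard $1$-sphere $S_n$ is the $n$-cycle $v_0,\dots,v_{n-1}$ with oriented edges $e_i\colon v_i\to v_{i+1}$ (indices mod $n$) and their inverses; $S_0$ is a single vertex. Let $\iota\colon S_n\to S_n$ be the reflection $v_i\mapsto v_{-i}$, which sends $e_i$ to $e_{n-1-i}^{-1}$. A \emph{$2$-complex} $X$ is a graph (its $1$-skeleton $X^{(1)}$) together with a set of faces, a fixed-point-free involution $\sigma\mapsto\sigma^{-1}$ on the faces and, for each face $\sigma$, a boundary sphere $X^\sigma=S_n$ ($n$ depending on $\sigma$) and a dimension preserving graph map $\alpha_\sigma\colon X^\sigma\to X^{(1)}$, such that $X^{\sigma^{-1}}=X^\sigma$ and $\alpha_{\sigma^{-1}}=\alpha_\sigma\iota$. It is connected if any two vertices are joined by an edge path. A \emph{dimension preserving map} $f\colon Y\to X$ sends vertices, edges and faces to vertices, edges and faces, commutes with $s$ and with inversion, and carries for each face $\sigma$ an orientation preserving isomorphism $\varepsilon(f,\sigma)\colon Y^\sigma\to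 X^{f(\sigma)}$ with $\alpha_{f(\sigma)}\,\varepsilon(f,\sigma)=f\alpha_\sigma$ and $\varepsilon(f,\sigma^{-1})=\iota\,\varepsilon(f,\sigma)\,\iota$. These isomorphisms are part of the map, both for equality of maps and for composition: $\varepsilon(gf,\sigma)=\varepsilon(g,f(\sigma))\,\varepsilon(f,\sigma)$. An \emph{isomorphism} is such a map that is bijective on vertices, edges and faces. A \emph{covering} is such a map for which, at every vertex $y$ of $Y$, the induced map from the edges starting at $y$ to the edges starting at $f(y)$ is bijective, and for every face $\tau$ of $X$ the map $\coprod_{f(\sigma)=\tau}\varepsilon(f,\sigma)\colon\bigsqcup_{f(\sigma)=\tau}\alpha_\sigma^{-1}(y)\to\alpha_\tau^{-1}(f(y))$ is bijective. Let $f\colon Y_u\to X_v$ be a pointed covering of connected $2$-complexes. A pointed connected intermediate covering is a factorisation $Y_u\xrightarrow{g}Z_z\xrightarrow{h}X_v$ of $f=hg$ into pointed coverings with $Z$ connected. Two of them are equivalent if there is an isomorphism $Z_1\to Z_2$ commuting with the $g_i$ and the $h_i$. Let $\mathcal L(Y_u,X_v)$ be the set of equivalence classes, and put $Z_1\le Z_2$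 if there is a covering $Z_2\to Z_1$ commuting with the $g_i$ and the $h_i$. \textbf{Theorem.} $\mathcal L(Y_u,X_v)$ with $\le$ is a partially ordered set and a lattice. For $Y_u\xrightarrow{g_i}(Z_i)_{z_i}\xrightarrow{h_i}X_v$ ($i=1,2$): (a) The join of their classes is the class of the pointed pullback $(Z_1\prod_XZ_2)_{z_1\times z_2}$. Here $Z_1\prod_XZ_2$ has as cells the pairs $x_1\times x_2$ of cells of the same dimension with $h_1(x_1)=h_2(x_2)$; a face $\sigma_1\times\sigma_2$ over $\sigma=h_i(\sigma_i)$ has boundary sphere $X^\sigma$ and attaching map $\alpha_{\sigma_1}\varepsilon(h_1,\sigma_1)^{-1}\times\alpha_{\sigma_2}\varepsilon(h_2,\sigma_2)^{-1}$; and one takes the connected component of the vertex $z_1\times z_2$. It is a pointed connected intermediate covering by $y\mapsto g_1(y)\times g_2(y)$ and $x_1\times x_2\mapsto h_1(x_1)$. (b) The meet of their classes is the class of the pointed pushout $(Z_1\coprod_YZ_2)_{[z_1]=[z_2]}$. Here $Z_1\coprod_YZ_2$ is the quotient of the disjoint union $Z_1\sqcup Z_2$ by the equivalence relation on cells generated by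 $g_1(y)\sim g_2(y)$ for the cells $y$ of $Y$, with quotient map $q$; for a face $\sigma$ of $Z_i$ the face $[\sigma]$ has boundary sphere $X^{h_i(\sigma)}$ and attaching map $q\,\alpha_\sigma\,\varepsilon(h_i,\sigma)^{-1}$. It is a pointed connected intermediate covering by $y\mapsto[g_1(y)]=[g_2(y)]$ and $[z]\mapsto h_i(z)$ ($z\in Z_i$). (c) The least element is the class of $Y_u\xrightarrow{f}X_v\xrightarrow{\mathrm{id}}X_v$, and the greatest element is the class of $Y_u\xrightarrow{\mathrm{id}}Y_u\xrightarrow{f}X_v$. -/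

import Mathlib

universe u v w

/-! ## Graphs -/

/-- A graph (`1`-complex): vertices, edges, the start vertex of an edge and a fixed-point-free
involution on the edges. The terminal vertex of `e` is `s (inv e)`. -/
structure OneComplex where
  V : Type u
  E : Type u
  s : E → V
  inv : E → E
  inv_inv : ∀ e, inv (inv e) = e
  inv_ne : ∀ e, inv e ≠ e

/-- A dimension preserving map of graphs. -/
@[ext]
structure OneComplex.Hom (X : OneComplex.{u}) (Y : OneComplex.{v}) where
  vert : X.V → Y.V
  edge : X.E → Y.E
  s_edge : ∀ e, Y.s (edge e) = vert (X.s e)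
  inv_edge : ∀ e, edge (X.inv e) = Y.inv (edge e)

/-- The identity map of a graph. -/
def OneComplex.Hom.id (X : OneComplex.{u}) : OneComplex.Hom X X where
  vert x := x
  edge e := e
  s_edge _ := rfl
  inv_edge _ := rfl

/-- Composition `g ∘ f` of maps of graphs. -/
def OneComplex.Hom.comp {X : OneComplex.{u}} {Y : OneComplex.{v}} {Z : OneComplex.{w}}
    (g : OneComplex.Hom Y Z) (f : OneComplex.Hom X Y) : OneComplex.Hom X Z where
  vert x := g.vert (f.vert x)
  edge e := g.edge (f.edge e)
  s_edge e := by rw [g.s_edge, f.s_edge]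
  inv_edge e := by rw [f.inv_edge, g.inv_edge]

/-- `w` can be joined to `x` by a path of edges. -/
def OneComplex.Joined (X : OneComplex.{u}) (x w : X.V) : Prop :=
  Relation.ReflTransGen (fun a b => ∃ e, X.s e = a ∧ X.s (X.inv e) = b) x w

/-- Any two vertices can be joined by a path. -/
def OneComplex.Connected (X : OneComplex.{u}) : Prop :=
  ∀ x w : X.V, X.Joined x w

theorem OneComplex.Hom.joined {X : OneComplex.{u}} {Y : OneComplex.{v}} (f : OneComplex.Hom X Y) {x w : X.V}
    (h : X.Joined x w) : Y.Joined (f.vert x) (f.vert w) := by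
  induction h with
  | refl => exact Relation.ReflTransGen.refl
  | tail _ h ih =>
    obtain ⟨e, rfl, rfl⟩ := h
    exact ih.tail ⟨f.edge e, f.s_edge e, by rw [← f.inv_edge, f.s_edge]⟩

/-! ## The standard `1`-spheres and their orientation preserving isomorphisms -/

/-- The standard `1`-sphere with `n` arcs: a cycle with vertices `v₀, …, vₙ₋₁` and
edges `eᵢ = (i, true)` from `vᵢ` to `vᵢ₊₁` (indices mod `n`) with inverses `(i, false)`;
for `n = 0` it is the trivial graph with a single vertex and no edges.
The standard orientation consists of the vertices and the edges `(i, true)`. -/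
abbrev sphere (n : ℕ) : OneComplex.{0} where
  V := Fin (n - 1 + 1)
  E := Fin n × Bool
  s e := Fin.ofNat (n - 1 + 1) (if e.2 then e.1.1 else e.1.1 + 1)
  inv e := (e.1, !e.2)
  inv_inv e := by simp
  inv_ne e h := by
    have := congrArg Prod.snd h
    simp at this

/-- Orientation preserving isomorphisms of standard `1`-spheres. -/
@[ext]
structure SphereIso (n m : ℕ) extends OneComplex.Hom (sphere n) (sphere m) where
  vert_bijective : Function.Bijective vert
  edge_bijective : Function.Bijective edge
  oriented : ∀ i, (edge (i, true)).2 = true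

namespace SphereIso

theorem snd_edge {n m : ℕ} (a : SphereIso n m) (e : Fin n × Bool) : (a.edge e).2 = e.2 := by
  obtain ⟨i, b⟩ := e
  cases b
  · have h : (i, false) = (sphere n).inv (i, true) := rfl
    rw [h, a.inv_edge]
    change (!(a.edge (i, true)).2) = false
    rw [a.oriented]; rfl
  · exact a.oriented i

def refl (n : ℕ) : SphereIso n n where
  toHom := OneComplex.Hom.id _
  vert_bijective := Function.bijective_id
  edge_bijective := Function.bijective_id
  oriented _ := rfl

/-- The composition `b ∘ a`. -/
def comp {n m k : ℕ} (b : SphereIso m k) (a : SphereIso n m) : SphereIso n k where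
  toHom := b.toHom.comp a.toHom
  vert_bijective := b.vert_bijective.comp a.vert_bijective
  edge_bijective := b.edge_bijective.comp a.edge_bijective
  oriented i := by
    change (b.edge (a.edge (i, true))).2 = true
    rw [b.snd_edge, a.oriented]

/-- The inverse isomorphism. -/
noncomputable def symm {n m : ℕ} (a : SphereIso n m) : SphereIso m n where
  vert := (Equiv.ofBijective _ a.vert_bijective).symm
  edge := (Equiv.ofBijective _ a.edge_bijective).symm
  s_edge e := by
    rw [Equiv.eq_symm_apply]
    change a.vert _ = _
    rw [← a.s_edge]
    exact congrArg _ ((Equiv.ofBijective _ a.edge_bijective).apply_symm_apply e)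
  inv_edge e := by
    rw [Equiv.symm_apply_eq]
    change _ = a.edge _
    rw [a.inv_edge]
    exact congrArg _ ((Equiv.ofBijective _ a.edge_bijective).apply_symm_apply e).symm
  vert_bijective := Equiv.bijective _
  edge_bijective := Equiv.bijective _
  oriented i := by
    rw [← a.snd_edge]
    exact congrArg Prod.snd ((Equiv.ofBijective _ a.edge_bijective).apply_symm_apply (i, true))

/-- The identity, viewed as an isomorphism between spheres with the same number of arcs. -/
def cast {n m : ℕ} (h : n = m) : SphereIso n m := h ▸ refl n

@[simp] theorem cast_rfl {n : ℕ} (h : n = n) : cast h = refl n := rfl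

@[simp] theorem refl_comp {n m : ℕ} (a : SphereIso n m) : (refl m).comp a = a := rfl
@[simp] theorem comp_refl {n m : ℕ} (a : SphereIso n m) : a.comp (refl n) = a := rfl
theorem comp_assoc {n m k l : ℕ} (c : SphereIso k l) (b : SphereIso m k) (a : SphereIso n m) :
    (c.comp b).comp a = c.comp (b.comp a) := rfl

@[simp] theorem symm_comp {n m : ℕ} (a : SphereIso n m) : a.symm.comp a = refl n := by
  ext1
  · exact funext fun x => (Equiv.ofBijective _ a.vert_bijective).symm_apply_apply x
  · exact funext fun x => (Equiv.ofBijective _ a.edge_bijective).symm_apply_apply x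

@[simp] theorem comp_symm {n m : ℕ} (a : SphereIso n m) : a.comp a.symm = refl m := by
  ext1
  · exact funext fun x => (Equiv.ofBijective _ a.vert_bijective).apply_symm_apply x
  · exact funext fun x => (Equiv.ofBijective _ a.edge_bijective).apply_symm_apply x

theorem comp_symm_cancel {n m k : ℕ} (b : SphereIso m k) (a : SphereIso n k) :
    b.comp (b.symm.comp a) = a := by
  rw [← comp_assoc, comp_symm, refl_comp]

theorem symm_comp_cancel {n m k : ℕ} (b : SphereIso m k) (a : SphereIso n m) :
    b.symm.comp (b.comp a) = a := by
  rw [← comp_assoc, symm_comp, refl_comp]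

theorem symm_comp_cast {n k₁ k₂ m₁ m₂ : ℕ} {a₁ : SphereIso n k₁} {b₁ : SphereIso k₁ m₁}
    {a₂ : SphereIso n k₂} {b₂ : SphereIso k₂ m₂} {h : m₁ = m₂}
    (hc : (cast h).comp (b₁.comp a₁) = b₂.comp a₂) :
    b₂.symm.comp (cast h) = a₂.comp (a₁.symm.comp b₁.symm) := by
  subst h
  have hc' : b₁.comp a₁ = b₂.comp a₂ := hc
  calc b₂.symm = b₂.symm.comp (b₁.comp ((a₁.comp a₁.symm).comp b₁.symm)) := by
        rw [comp_symm, refl_comp, comp_symm, comp_refl]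
    _ = b₂.symm.comp ((b₁.comp a₁).comp (a₁.symm.comp b₁.symm)) := rfl
    _ = b₂.symm.comp (b₂.comp (a₂.comp (a₁.symm.comp b₁.symm))) := by rw [hc']; rfl
    _ = _ := symm_comp_cancel _ _

end SphereIso

/-- The orientation reversing map `ι` of the standard `1`-sphere: it fixes `v₀` and
interchanges `eᵢ` with the inverse of `eₙ₋₁₋ᵢ`. -/
def reflection (n : ℕ) : OneComplex.Hom (sphere n) (sphere n) where
  vert j := Fin.ofNat (n - 1 + 1) (n - j.1)
  edge e := (e.1.rev, !e.2)
  s_edge e := by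
    obtain ⟨i, b⟩ := e
    have hi := i.isLt
    apply Fin.ext
    obtain ⟨k, rfl⟩ : ∃ k, n = k + 1 := ⟨n - 1, by omega⟩
    cases b
    · simp only [Fin.ofNat, Fin.val_rev]
      rcases Nat.lt_or_ge (i.1 + 1) (k + 1) with h | h
      · simp [Nat.mod_eq_of_lt h]
      · have : i.1 = k := by omega
        simp [this]
    · simp only [Fin.ofNat, Fin.val_rev]
      simp [Nat.mod_eq_of_lt hi]
      congr 1
      omega
  inv_edge e := rfl

/-- `ι`, viewed as a map between spheres with the same number of arcs. -/
def reflect {n m : ℕ} (h : n = m) : OneComplex.Hom (sphere n) (sphere m) :=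
  (SphereIso.cast h).toHom.comp (reflection n)

theorem cast_comp_reflect {n m k : ℕ} (h : m = k) (h' : n = m) :
    (SphereIso.cast h).toHom.comp (reflect h') = reflect (h'.trans h) := by
  subst h h'; rfl

theorem reflect_comp_symm {n n' m m' : ℕ} {a : n' = n} {b : m' = m} {e : SphereIso n m}
    {e' : SphereIso n' m'} (h : (reflect b).comp e'.toHom = e.toHom.comp (reflect a)) :
    (reflect a).comp e'.symm.toHom = e.symm.toHom.comp (reflect b) := by
  calc (reflect a).comp e'.symm.toHom
      = (e.symm.comp e).toHom.comp ((reflect a).comp e'.symm.toHom) := by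
        rw [SphereIso.symm_comp]; rfl
    _ = e.symm.toHom.comp ((e.toHom.comp (reflect a)).comp e'.symm.toHom) := rfl
    _ = e.symm.toHom.comp ((reflect b).comp (e'.comp e'.symm).toHom) := by rw [← h]; rfl
    _ = e.symm.toHom.comp (reflect b) := by rw [SphereIso.comp_symm]; rfl

/-! ## `2`-complexes and their dimension preserving maps -/

/-- A combinatorial `2`-complex. The `1`-skeleton is `toOneComplex`; `F` is the set of faces, `finv` the
fixed-point-free inversion of faces. The boundary of `σ` is the `1`-sphere with `len σ` arcs,
together with the attaching map `att σ`; the inverse face has the same sphere and the attaching map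
`att σ ∘ ι`. -/
structure TwoComplex extends OneComplex.{u} where
  F : Type u
  finv : F → F
  finv_finv : ∀ σ, finv (finv σ) = σ
  finv_ne : ∀ σ, finv σ ≠ σ
  len : F → ℕ
  att : ∀ σ, OneComplex.Hom (sphere (len σ)) toOneComplex
  len_finv : ∀ σ, len (finv σ) = len σ
  att_finv : ∀ σ, att (finv σ) = (att σ).comp (reflect (len_finv σ))

namespace TwoComplex

/-- A dimension preserving map `f : X → Y` of `2`-complexes. It carries, for each face `σ`,
an orientation preserving isomorphism `ε σ = ε(f, σ)` from the boundary sphere of `σ` to the one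
of `f σ`, compatible with the attaching maps. It is compatible with inversion of faces:
`ι ∘ ε(f, σ⁻¹) = ε(f, σ) ∘ ι`. Two maps are equal when they agree on all cells and have the
same `ε(f, σ)`. -/
structure Hom (X : TwoComplex.{u}) (Y : TwoComplex.{v}) extends
    OneComplex.Hom X.toOneComplex Y.toOneComplex where
  face : X.F → Y.F
  face_finv : ∀ σ, face (X.finv σ) = Y.finv (face σ)
  ε : ∀ σ, SphereIso (X.len σ) (Y.len (face σ))
  att_ε : ∀ σ, (Y.att (face σ)).comp (ε σ).toHom = toHom.comp (X.att σ)
  ε_finv : ∀ σ, (reflect ((congrArg Y.len (face_finv σ)).trans (Y.len_finv _))).comp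
      (ε (X.finv σ)).toHom = (ε σ).toHom.comp (reflect (X.len_finv σ))

namespace Hom

/-- The identity map. -/
def id (X : TwoComplex.{u}) : Hom X X where
  toHom := OneComplex.Hom.id _
  face σ := σ
  face_finv _ := rfl
  ε _ := SphereIso.refl _
  att_ε _ := rfl
  ε_finv _ := rfl

/-- The composition `g ∘ f`, with `ε(g ∘ f, σ) = ε(g, f σ) ∘ ε(f, σ)`. -/
def comp {X : TwoComplex.{u}} {Y : TwoComplex.{v}} {Z : TwoComplex.{w}}
    (g : Hom Y Z) (f : Hom X Y) : Hom X Z where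
  toHom := g.toHom.comp f.toHom
  face σ := g.face (f.face σ)
  face_finv _ := by rw [f.face_finv, g.face_finv]
  ε σ := (g.ε (f.face σ)).comp (f.ε σ)
  att_ε σ := by
    change ((Z.att _).comp (g.ε _).toHom).comp (f.ε σ).toHom = _
    rw [g.att_ε]
    change g.toHom.comp ((Y.att _).comp (f.ε σ).toHom) = _
    rw [f.att_ε]
    rfl
  ε_finv σ := by
    have key : ∀ (τ : Y.F) (_ : τ = Y.finv (f.face σ)) (hl : Y.len τ = Y.len (f.face σ))
        (hm : Z.len (g.face τ) = Z.len (g.face (f.face σ))),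
        (reflect hm).comp (g.ε τ).toHom = (g.ε (f.face σ)).toHom.comp (reflect hl) := by
      rintro τ rfl hl hm
      exact g.ε_finv _
    change ((reflect _).comp (g.ε _).toHom).comp (f.ε _).toHom = _
    rw [key _ (f.face_finv σ) ((congrArg Y.len (f.face_finv σ)).trans (Y.len_finv _))]
    change (g.ε _).toHom.comp ((reflect _).comp (f.ε _).toHom) = _
    rw [f.ε_finv]
    rfl

theorem ext_of {X : TwoComplex.{u}} {Y : TwoComplex.{v}} {f g : Hom X Y}
    (hv : ∀ x, f.vert x = g.vert x) (he : ∀ x, f.edge x = g.edge x)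
    (hf : ∀ σ, f.face σ = g.face σ)
    (hε : ∀ σ, (SphereIso.cast (congrArg Y.len (hf σ))).comp (f.ε σ) = g.ε σ) : f = g := by
  obtain ⟨⟨fv, fe, _, _⟩, ff, _, fε, _, _⟩ := f
  obtain ⟨⟨gv, ge, _, _⟩, gf, _, gε, _, _⟩ := g
  obtain rfl : fv = gv := funext hv
  obtain rfl : fe = ge := funext he
  obtain rfl : ff = gf := funext hf
  obtain rfl : fε = gε := funext hε
  rfl

theorem ε_congr {X : TwoComplex.{u}} {Y : TwoComplex.{v}} {f g : Hom X Y} (h : f = g) (σ : X.F)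
    (hl : Y.len (f.face σ) = Y.len (g.face σ)) :
    (SphereIso.cast hl).comp (f.ε σ) = g.ε σ := by
  subst h; rfl

/-- An isomorphism: bijective on vertices, edges and faces (and dimension preserving). -/
structure IsIso {X : TwoComplex.{u}} {Y : TwoComplex.{v}} (f : Hom X Y) : Prop where
  vert : Function.Bijective f.vert
  edge : Function.Bijective f.edge
  face : Function.Bijective f.face

/-- Local continuity at the vertex `x`, on the edges starting at `x`. -/
def localEdge {X : TwoComplex.{u}} {Y : TwoComplex.{v}} (f : Hom X Y) (x : X.V)
    (e : {e : X.E // X.s e = x}) : {e : Y.E // Y.s e = f.vert x} :=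
  ⟨f.edge e.1, by rw [f.s_edge, e.2]⟩

end Hom

/-- The appearances of the vertex `x` in the boundaries of the faces of `X`: a face `σ`
and a vertex of its boundary sphere that `att σ` sends to `x`. -/
def Appearance (X : TwoComplex.{u}) (x : X.V) : Type u :=
  {p : Σ σ : X.F, (sphere (X.len σ)).V // (X.att p.1).vert p.2 = x}

namespace Hom

/-- Local continuity at the vertex `x`, on the appearances of `x` in the boundaries of faces:
the disjoint union of the maps `ε(f, σ)`. It sends the appearances in faces `σ` with `f σ = τ` to
appearances in `τ`, so it is bijective if and only if for every face `τ` of `Y` it restricts to a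
bijection from the appearances of `x` in the faces of the fibre of `τ` to the appearances of `f x`
in `τ`. -/
def localFace {X : TwoComplex.{u}} {Y : TwoComplex.{v}} (f : Hom X Y) (x : X.V)
    (p : X.Appearance x) : Y.Appearance (f.vert x) :=
  ⟨⟨f.face p.1.1, (f.ε p.1.1).vert p.1.2⟩, by
    have := congrArg (fun k => OneComplex.Hom.vert k p.1.2) (f.att_ε p.1.1)
    exact this.trans (congrArg f.vert p.2)⟩

/-- Coverings: dimension preserving maps all of whose local continuity maps are bijections. -/
structure IsCovering {X : TwoComplex.{u}} {Y : TwoComplex.{v}} (f : Hom X Y) : Prop where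
  edge : ∀ x, Function.Bijective (f.localEdge x)
  face : ∀ x, Function.Bijective (f.localFace x)

theorem IsCovering.comp {X : TwoComplex.{u}} {Y : TwoComplex.{v}} {Z : TwoComplex.{w}}
    {g : Hom Y Z} {f : Hom X Y} (hg : g.IsCovering) (hf : f.IsCovering) :
    (g.comp f).IsCovering :=
  ⟨fun x => (hg.edge (f.vert x)).comp (hf.edge x),
    fun x => (hg.face (f.vert x)).comp (hf.face x)⟩

theorem isIso_id (X : TwoComplex.{u}) : (id X).IsIso :=
  ⟨Function.bijective_id, Function.bijective_id, Function.bijective_id⟩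

theorem IsIso.comp {X : TwoComplex.{u}} {Y : TwoComplex.{v}} {Z : TwoComplex.{w}}
    {g : Hom Y Z} {f : Hom X Y} (hg : g.IsIso) (hf : f.IsIso) : (g.comp f).IsIso :=
  ⟨hg.vert.comp hf.vert, hg.edge.comp hf.edge, hg.face.comp hf.face⟩

theorem IsIso.isCovering {X : TwoComplex.{u}} {Y : TwoComplex.{v}} {f : Hom X Y}
    (hf : f.IsIso) : f.IsCovering := by
  refine ⟨fun x => ⟨?_, ?_⟩, fun x => ⟨?_, ?_⟩⟩
  · rintro ⟨a, ha⟩ ⟨b, hb⟩ h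
    exact Subtype.ext (hf.edge.1 (congrArg Subtype.val h))
  · rintro ⟨e, he⟩
    obtain ⟨e, rfl⟩ := hf.edge.2 e
    rw [f.s_edge] at he
    exact ⟨⟨e, hf.vert.1 he⟩, rfl⟩
  · rintro ⟨⟨σ, a⟩, ha⟩ ⟨⟨τ, b⟩, hb⟩ h
    have h1 := congrArg Subtype.val h
    simp only [localFace, Sigma.mk.injEq] at h1
    obtain ⟨h1, h2⟩ := h1
    obtain rfl := hf.face.1 h1
    obtain rfl := (f.ε σ).vert_bijective.1 (eq_of_heq h2)
    rfl
  · rintro ⟨⟨τ, b⟩, hb⟩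
    obtain ⟨σ, rfl⟩ := hf.face.2 τ
    obtain ⟨a, rfl⟩ := (f.ε σ).vert_bijective.2 b
    refine ⟨⟨⟨σ, a⟩, hf.vert.1 ?_⟩, rfl⟩
    rw [← hb]
    exact (congrArg (fun k => OneComplex.Hom.vert k a) (f.att_ε σ)).symm

/-- An isomorphism has an inverse that is an isomorphism. -/
theorem IsIso.exists_inverse {X : TwoComplex.{u}} {Y : TwoComplex.{v}} {f : Hom X Y}
    (hf : f.IsIso) : ∃ g : Hom Y X, g.IsIso ∧ g.comp f = id X ∧ f.comp g = id Y := by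
  obtain ⟨gv, hv1, hv2⟩ := Function.bijective_iff_has_inverse.1 hf.vert
  obtain ⟨ge, he1, he2⟩ := Function.bijective_iff_has_inverse.1 hf.edge
  obtain ⟨gf, hf1, hf2⟩ := Function.bijective_iff_has_inverse.1 hf.face
  have hfi : ∀ τ, gf (Y.finv τ) = X.finv (gf τ) := fun τ => by
    apply hf.face.1; rw [hf2, f.face_finv, hf2]
  let g1 : OneComplex.Hom Y.toOneComplex X.toOneComplex :=
    { vert := gv
      edge := ge
      s_edge := fun e => by apply hf.vert.1; rw [← f.s_edge, he2, hv2]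
      inv_edge := fun e => by apply hf.edge.1; rw [he2, f.inv_edge, he2] }
  have hg1 : g1.comp f.toHom = OneComplex.Hom.id _ :=
    OneComplex.Hom.ext (funext hv1) (funext he1)
  have hatt : ∀ (σ : X.F) (τ : Y.F) (h : f.face σ = τ),
      (X.att σ).comp ((f.ε σ).symm.comp (SphereIso.cast (congrArg Y.len h.symm))).toHom =
        g1.comp (Y.att τ) := by
    rintro σ _ rfl
    calc (X.att σ).comp (f.ε σ).symm.toHom
        = ((g1.comp f.toHom).comp (X.att σ)).comp (f.ε σ).symm.toHom := by rw [hg1]; rfl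
      _ = g1.comp ((f.toHom.comp (X.att σ)).comp (f.ε σ).symm.toHom) := rfl
      _ = g1.comp ((Y.att _).comp ((f.ε σ).comp (f.ε σ).symm).toHom) := by
          rw [← f.att_ε]; rfl
      _ = g1.comp (Y.att _) := by rw [SphereIso.comp_symm]; rfl
  have hrefl : ∀ (σ σ' : X.F) (τ τ' : Y.F) (h : f.face σ = τ) (h' : f.face σ' = τ')
      (_ : σ' = X.finv σ) (a : X.len σ' = X.len σ) (b : Y.len τ' = Y.len τ),
      (reflect a).comp ((f.ε σ').symm.comp (SphereIso.cast (congrArg Y.len h'.symm))).toHom =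
        ((f.ε σ).symm.comp (SphereIso.cast (congrArg Y.len h.symm))).toHom.comp (reflect b) := by
    rintro σ _ _ _ rfl rfl rfl a b
    exact reflect_comp_symm (f.ε_finv σ)
  let g : Hom Y X :=
    { toHom := g1
      face := gf
      face_finv := hfi
      ε := fun τ => (f.ε (gf τ)).symm.comp (SphereIso.cast (congrArg Y.len (hf2 τ).symm))
      att_ε := fun τ => hatt _ _ (hf2 τ)
      ε_finv := fun τ => hrefl _ _ _ _ (hf2 τ) (hf2 _) (hfi τ) _ _ }
  refine ⟨g, ⟨⟨hv2.injective, hv1.surjective⟩, ⟨he2.injective, he1.surjective⟩,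
    ⟨hf2.injective, hf1.surjective⟩⟩, ext_of hv1 he1 hf1 ?_, ext_of hv2 he2 hf2 ?_⟩
  · intro σ
    have key : ∀ (σ' : X.F) (h : σ' = σ) (h' : f.face σ' = f.face σ),
        (SphereIso.cast (congrArg X.len h)).comp (((f.ε σ').symm.comp
          (SphereIso.cast (congrArg Y.len h'.symm))).comp (f.ε σ)) = SphereIso.refl _ := by
      rintro _ rfl h'
      exact SphereIso.symm_comp _
    exact key _ (hf1 σ) (hf2 _)
  · intro τ
    have key : ∀ (σ : X.F) (τ : Y.F) (h : f.face σ = τ),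
        (SphereIso.cast (congrArg Y.len h)).comp ((f.ε σ).comp ((f.ε σ).symm.comp
          (SphereIso.cast (congrArg Y.len h.symm)))) = SphereIso.refl _ := by
      rintro σ _ rfl
      exact SphereIso.comp_symm _
    exact key _ _ (hf2 τ)

theorem att_ε_symm {X : TwoComplex.{u}} {Y : TwoComplex.{v}} (f : Hom X Y) (σ : X.F) :
    f.toHom.comp ((X.att σ).comp (f.ε σ).symm.toHom) = Y.att (f.face σ) := by
  change (f.toHom.comp (X.att σ)).comp (f.ε σ).symm.toHom = _
  rw [← f.att_ε]
  change (Y.att (f.face σ)).comp ((f.ε σ).comp (f.ε σ).symm).toHom = _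
  rw [SphereIso.comp_symm]
  rfl

theorem ε_finv_symm {X : TwoComplex.{u}} {Y : TwoComplex.{v}} (f : Hom X Y) (σ : X.F) :
    (reflect (X.len_finv σ)).comp (f.ε (X.finv σ)).symm.toHom = (f.ε σ).symm.toHom.comp
      (reflect ((congrArg Y.len (f.face_finv σ)).trans (Y.len_finv _))) :=
  reflect_comp_symm (f.ε_finv σ)

end Hom

theorem att_cast (X : TwoComplex.{u}) {σ τ : X.F} (h : σ = τ) :
    (X.att τ).comp (SphereIso.cast (congrArg X.len h)).toHom = X.att σ := by
  subst h; rfl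

/-! ## Connected components -/

/-- The connected component of `X` containing the vertex `x`: the vertices that can be
joined to `x`, the edges incident with them, and the faces whose boundary lies in it. -/
def component (X : TwoComplex.{u}) (x : X.V) : TwoComplex.{u} where
  V := {w : X.V // X.Joined x w}
  E := {e : X.E // X.Joined x (X.s e)}
  s e := ⟨X.s e.1, e.2⟩
  inv e := ⟨X.inv e.1, e.2.tail ⟨e.1, rfl, rfl⟩⟩
  inv_inv e := Subtype.ext (X.inv_inv e.1)
  inv_ne e h := X.inv_ne e.1 (congrArg Subtype.val h)
  F := {σ : X.F // ∀ i, X.Joined x ((X.att σ).vert i)}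
  finv σ := ⟨X.finv σ.1, fun _ => by rw [X.att_finv]; exact σ.2 _⟩
  finv_finv σ := Subtype.ext (X.finv_finv σ.1)
  finv_ne σ h := X.finv_ne σ.1 (congrArg Subtype.val h)
  len σ := X.len σ.1
  att σ :=
    { vert := fun i => ⟨(X.att σ.1).vert i, σ.2 i⟩
      edge := fun e => ⟨(X.att σ.1).edge e, by rw [(X.att σ.1).s_edge]; exact σ.2 _⟩
      s_edge := fun e => Subtype.ext ((X.att σ.1).s_edge e)
      inv_edge := fun e => Subtype.ext ((X.att σ.1).inv_edge e) }
  len_finv σ := X.len_finv σ.1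
  att_finv σ := by
    have h := X.att_finv σ.1
    ext1
    · exact funext fun i => Subtype.ext (congrArg (fun k => OneComplex.Hom.vert k i) h)
    · exact funext fun e => Subtype.ext (congrArg (fun k => OneComplex.Hom.edge k e) h)

/-- The inclusion of a connected component. -/
def component.incl (X : TwoComplex.{u}) (x : X.V) : Hom (X.component x) X where
  vert a := a.1
  edge e := e.1
  s_edge _ := rfl
  inv_edge _ := rfl
  face σ := σ.1
  face_finv _ := rfl
  ε _ := SphereIso.refl _
  att_ε _ := rfl
  ε_finv _ := rfl

/-- A map from a connected complex, viewed as a map to the connected component of the image of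
a vertex. -/
def component.restrict {Y : TwoComplex.{v}} {X : TwoComplex.{u}} (hY : Y.Connected)
    (f : Hom Y X) (y : Y.V) (x : X.V) (h : f.vert y = x) : Hom Y (X.component x) :=
  have key : ∀ a, X.Joined x (f.vert a) := fun a => h ▸ f.toHom.joined (hY y a)
  { vert := fun a => ⟨f.vert a, key a⟩
    edge := fun e => ⟨f.edge e, by rw [f.s_edge]; exact key _⟩
    s_edge := fun e => Subtype.ext (f.s_edge e)
    inv_edge := fun e => Subtype.ext (f.inv_edge e)
    face := fun σ => ⟨f.face σ, fun i => by
      obtain ⟨j, rfl⟩ := (f.ε σ).vert_bijective.2 i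
      have := congrArg (fun k => OneComplex.Hom.vert k j) (f.att_ε σ)
      exact this ▸ key _⟩
    face_finv := fun σ => Subtype.ext (f.face_finv σ)
    ε := f.ε
    att_ε := fun σ => by
      have h := f.att_ε σ
      ext1
      · exact funext fun i => Subtype.ext (congrArg (fun k => OneComplex.Hom.vert k i) h)
      · exact funext fun e => Subtype.ext (congrArg (fun k => OneComplex.Hom.edge k e) h)
    ε_finv := f.ε_finv }

/-! ## Pullbacks -/

section Pullback

variable {Z₁ Z₂ X : TwoComplex.{u}}

/-- The `1`-skeleton of the pullback. -/
def pullback₁ (h₁ : Hom Z₁ X) (h₂ : Hom Z₂ X) : OneComplex.{u} where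
  V := {p : Z₁.V × Z₂.V // h₁.vert p.1 = h₂.vert p.2}
  E := {p : Z₁.E × Z₂.E // h₁.edge p.1 = h₂.edge p.2}
  s e := ⟨(Z₁.s e.1.1, Z₂.s e.1.2), by
    change h₁.vert (Z₁.s _) = h₂.vert (Z₂.s _)
    rw [← h₁.s_edge, ← h₂.s_edge, e.2]⟩
  inv e := ⟨(Z₁.inv e.1.1, Z₂.inv e.1.2), by
    change h₁.edge (Z₁.inv _) = h₂.edge (Z₂.inv _)
    rw [h₁.inv_edge, h₂.inv_edge, e.2]⟩
  inv_inv e := Subtype.ext (Prod.ext (Z₁.inv_inv _) (Z₂.inv_inv _))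
  inv_ne e h := Z₁.inv_ne e.1.1 (congrArg (fun p => p.1.1) h)

/-- The map `a₁ × a₂` to the pullback. -/
def pullback₁.pair {h₁ : Hom Z₁ X} {h₂ : Hom Z₂ X} {A : OneComplex.{v}}
    (a₁ : OneComplex.Hom A Z₁.toOneComplex) (a₂ : OneComplex.Hom A Z₂.toOneComplex)
    (H : h₁.toHom.comp a₁ = h₂.toHom.comp a₂) : OneComplex.Hom A (pullback₁ h₁ h₂) where
  vert x := ⟨(a₁.vert x, a₂.vert x), congrArg (fun k => OneComplex.Hom.vert k x) H⟩
  edge e := ⟨(a₁.edge e, a₂.edge e), congrArg (fun k => OneComplex.Hom.edge k e) H⟩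
  s_edge e := Subtype.ext (Prod.ext (a₁.s_edge e) (a₂.s_edge e))
  inv_edge e := Subtype.ext (Prod.ext (a₁.inv_edge e) (a₂.inv_edge e))

theorem pullback₁.ext {h₁ : Hom Z₁ X} {h₂ : Hom Z₂ X} {A : OneComplex.{v}}
    {a b : OneComplex.Hom A (pullback₁ h₁ h₂)}
    (hv1 : ∀ x, (a.vert x).1.1 = (b.vert x).1.1) (hv2 : ∀ x, (a.vert x).1.2 = (b.vert x).1.2)
    (he1 : ∀ x, (a.edge x).1.1 = (b.edge x).1.1) (he2 : ∀ x, (a.edge x).1.2 = (b.edge x).1.2) :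
    a = b :=
  OneComplex.Hom.ext (funext fun x => Subtype.ext (Prod.ext (hv1 x) (hv2 x)))
    (funext fun x => Subtype.ext (Prod.ext (he1 x) (he2 x)))

/-- The pullback of `h₁ : Z₁ → X` and `h₂ : Z₂ → X`. Its cells are the pairs of cells with the
same image in `X`; the boundary of the face `(σ₁, σ₂)` is the boundary sphere of the common image
`σ` in `X`, with the attaching map whose coordinates are `att σ₁ ∘ ε(h₁, σ₁)⁻¹` and
`att σ₂ ∘ ε(h₂, σ₂)⁻¹`. -/
noncomputable def pullback (h₁ : Hom Z₁ X) (h₂ : Hom Z₂ X) : TwoComplex.{u} where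
  toOneComplex := pullback₁ h₁ h₂
  F := {p : Z₁.F × Z₂.F // h₁.face p.1 = h₂.face p.2}
  finv σ := ⟨(Z₁.finv σ.1.1, Z₂.finv σ.1.2), 
    (h₁.face_finv _).trans ((congrArg X.finv σ.2).trans (h₂.face_finv _).symm)⟩
  finv_finv σ := Subtype.ext (Prod.ext (Z₁.finv_finv _) (Z₂.finv_finv _))
  finv_ne σ h := Z₁.finv_ne σ.1.1 (congrArg (fun p => p.1.1) h)
  len σ := X.len (h₁.face σ.1.1)
  att σ := pullback₁.pair
    ((Z₁.att σ.1.1).comp (h₁.ε σ.1.1).symm.toHom)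
    ((Z₂.att σ.1.2).comp ((h₂.ε σ.1.2).symm.comp
      (SphereIso.cast (congrArg X.len σ.2))).toHom)
    (by
      rw [h₁.att_ε_symm]
      change _ = (h₂.toHom.comp ((Z₂.att σ.1.2).comp (h₂.ε σ.1.2).symm.toHom)).comp
        (SphereIso.cast (congrArg X.len σ.2)).toHom
      rw [h₂.att_ε_symm]
      exact (X.att_cast σ.2).symm)
  len_finv σ := (congrArg X.len (h₁.face_finv σ.1.1)).trans (X.len_finv _)
  att_finv σ := by
    have e1 : (Z₁.att (Z₁.finv σ.1.1)).comp (h₁.ε (Z₁.finv σ.1.1)).symm.toHom =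
        ((Z₁.att σ.1.1).comp (h₁.ε σ.1.1).symm.toHom).comp
          (reflect ((congrArg X.len (h₁.face_finv σ.1.1)).trans (X.len_finv _))) := by
      rw [Z₁.att_finv]
      exact congrArg (OneComplex.Hom.comp (Z₁.att σ.1.1)) (h₁.ε_finv_symm σ.1.1)
    have e2 : ∀ (n m : ℕ) (hn : n = X.len (h₂.face (Z₂.finv σ.1.2)))
        (hm : m = X.len (h₂.face σ.1.2)) (hnm : n = m),
        (Z₂.att (Z₂.finv σ.1.2)).comp
          ((h₂.ε (Z₂.finv σ.1.2)).symm.comp (SphereIso.cast hn)).toHom =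
        ((Z₂.att σ.1.2).comp ((h₂.ε σ.1.2).symm.comp (SphereIso.cast hm)).toHom).comp
          (reflect hnm) := by
      rintro n m rfl hm rfl
      rw [Z₂.att_finv]
      refine (congrArg (OneComplex.Hom.comp (Z₂.att σ.1.2)) (h₂.ε_finv_symm σ.1.2)).trans ?_
      change _ = ((Z₂.att σ.1.2).comp (h₂.ε σ.1.2).symm.toHom).comp
        ((SphereIso.cast hm).toHom.comp (reflect rfl))
      rw [cast_comp_reflect]
      rfl
    have e2' := e2 _ _ (congrArg X.len 
      ((h₁.face_finv _).trans ((congrArg X.finv σ.2).trans (h₂.face_finv _).symm)))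
      (congrArg X.len σ.2) ((congrArg X.len (h₁.face_finv σ.1.1)).trans (X.len_finv _))
    exact pullback₁.ext (fun x => congrArg (fun k => OneComplex.Hom.vert k x) e1)
      (fun x => congrArg (fun k => OneComplex.Hom.vert k x) e2')
      (fun x => congrArg (fun k => OneComplex.Hom.edge k x) e1)
      (fun x => congrArg (fun k => OneComplex.Hom.edge k x) e2')

/-- The projection `t₁` of the pullback to `Z₁`. -/
noncomputable def pullback.fst (h₁ : Hom Z₁ X) (h₂ : Hom Z₂ X) : Hom (pullback h₁ h₂) Z₁ where
  vert p := p.1.1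
  edge p := p.1.1
  s_edge _ := rfl
  inv_edge _ := rfl
  face σ := σ.1.1
  face_finv _ := rfl
  ε σ := (h₁.ε σ.1.1).symm
  att_ε _ := rfl
  ε_finv σ := h₁.ε_finv_symm σ.1.1

/-- The map `y ↦ (g₁ y, g₂ y)` to the pullback, for `h₁ ∘ g₁ = h₂ ∘ g₂`. -/
noncomputable def pullback.lift {Y : TwoComplex.{u}} {h₁ : Hom Z₁ X} {h₂ : Hom Z₂ X}
    (g₁ : Hom Y Z₁) (g₂ : Hom Y Z₂) (H : h₁.comp g₁ = h₂.comp g₂) : Hom Y (pullback h₁ h₂) where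
  toHom := pullback₁.pair g₁.toHom g₂.toHom (congrArg Hom.toHom H)
  face σ := ⟨(g₁.face σ, g₂.face σ), congrArg (fun k => Hom.face k σ) H⟩
  face_finv σ := Subtype.ext (Prod.ext (g₁.face_finv σ) (g₂.face_finv σ))
  ε σ := (h₁.comp g₁).ε σ
  att_ε σ := by
    have e1 : ((Z₁.att (g₁.face σ)).comp (h₁.ε (g₁.face σ)).symm.toHom).comp
        ((h₁.comp g₁).ε σ).toHom = g₁.toHom.comp (Y.att σ) := by
      rw [← g₁.att_ε]
      exact congrArg (fun k => (Z₁.att (g₁.face σ)).comp (SphereIso.toHom k))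
        (SphereIso.symm_comp_cancel (h₁.ε (g₁.face σ)) (g₁.ε σ))
    have hl : X.len (h₁.face (g₁.face σ)) = X.len (h₂.face (g₂.face σ)) :=
      congrArg X.len (congrArg (fun k => Hom.face k σ) H)
    have e2 : ((Z₂.att (g₂.face σ)).comp ((h₂.ε (g₂.face σ)).symm.comp
        (SphereIso.cast hl)).toHom).comp ((h₁.comp g₁).ε σ).toHom =
          g₂.toHom.comp (Y.att σ) := by
      rw [← g₂.att_ε]
      change (Z₂.att (g₂.face σ)).comp ((h₂.ε (g₂.face σ)).symm.comp
        ((SphereIso.cast hl).comp ((h₁.comp g₁).ε σ))).toHom = _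
      refine (congrArg (fun k => (Z₂.att (g₂.face σ)).comp
        (SphereIso.toHom ((h₂.ε (g₂.face σ)).symm.comp k))) (Hom.ε_congr H σ hl)).trans ?_
      exact congrArg (fun k => (Z₂.att (g₂.face σ)).comp (SphereIso.toHom k))
        (SphereIso.symm_comp_cancel (h₂.ε (g₂.face σ)) (g₂.ε σ))
    exact pullback₁.ext (fun x => congrArg (fun k => OneComplex.Hom.vert k x) e1)
      (fun x => congrArg (fun k => OneComplex.Hom.vert k x) e2)
      (fun x => congrArg (fun k => OneComplex.Hom.edge k x) e1)
      (fun x => congrArg (fun k => OneComplex.Hom.edge k x) e2)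
  ε_finv σ := (h₁.comp g₁).ε_finv σ

end Pullback

/-! ## Pushouts -/

/-- The relation on a disjoint union `B ∪ C` that relates `p a` to `q a` for all `a`.
The quotient `Quot (Glue p q)` is the quotient by the equivalence relation it generates. -/
inductive Glue {A B C : Type u} (p : A → B) (q : A → C) : B ⊕ C → B ⊕ C → Prop
  | mk (a : A) : Glue p q (Sum.inl (p a)) (Sum.inr (q a))

section Pushout

variable {Y Z₁ Z₂ X : TwoComplex.{u}}

/-- The map on edges from the pushout of `g₁`, `g₂` induced by `h₁`, `h₂`. -/
def pushout.edgeMap (g₁ : Hom Y Z₁) (g₂ : Hom Y Z₂) (h₁ : Hom Z₁ X) (h₂ : Hom Z₂ X)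
    (H : h₁.comp g₁ = h₂.comp g₂) : Quot (Glue g₁.edge g₂.edge) → X.E :=
  Quot.lift (Sum.elim h₁.edge h₂.edge)
    (by rintro _ _ ⟨a⟩; exact congrArg (fun k : Hom Y X => k.edge a) H)

/-- The map on faces from the pushout of `g₁`, `g₂` induced by `h₁`, `h₂`. -/
def pushout.faceMap (g₁ : Hom Y Z₁) (g₂ : Hom Y Z₂) (h₁ : Hom Z₁ X) (h₂ : Hom Z₂ X)
    (H : h₁.comp g₁ = h₂.comp g₂) : Quot (Glue g₁.face g₂.face) → X.F :=
  Quot.lift (Sum.elim h₁.face h₂.face)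
    (by rintro _ _ ⟨a⟩; exact congrArg (fun k => Hom.face k a) H)

/-- The inversion of edges in the pushout: `[e]⁻¹ = [e⁻¹]`. -/
def pushout.inv (g₁ : Hom Y Z₁) (g₂ : Hom Y Z₂) :
    Quot (Glue g₁.edge g₂.edge) → Quot (Glue g₁.edge g₂.edge) :=
  Quot.map (Sum.map Z₁.inv Z₂.inv) (by
    rintro _ _ ⟨a⟩
    change Glue _ _ (Sum.inl (Z₁.inv _)) (Sum.inr (Z₂.inv _))
    rw [← g₁.inv_edge, ← g₂.inv_edge]
    exact ⟨_⟩)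

/-- The inversion of faces in the pushout: `[σ]⁻¹ = [σ⁻¹]`. -/
def pushout.finv (g₁ : Hom Y Z₁) (g₂ : Hom Y Z₂) :
    Quot (Glue g₁.face g₂.face) → Quot (Glue g₁.face g₂.face) :=
  Quot.map (Sum.map Z₁.finv Z₂.finv) (by
    rintro _ _ ⟨a⟩
    change Glue _ _ (Sum.inl (Z₁.finv _)) (Sum.inr (Z₂.finv _))
    rw [← g₁.face_finv, ← g₂.face_finv]
    exact ⟨_⟩)

theorem pushout.edgeMap_inv (g₁ : Hom Y Z₁) (g₂ : Hom Y Z₂) (h₁ : Hom Z₁ X) (h₂ : Hom Z₂ X)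
    (H : h₁.comp g₁ = h₂.comp g₂) (e : Quot (Glue g₁.edge g₂.edge)) :
    edgeMap g₁ g₂ h₁ h₂ H (inv g₁ g₂ e) = X.inv (edgeMap g₁ g₂ h₁ h₂ H e) := by
  rcases e with ⟨e | e⟩
  · exact h₁.inv_edge e
  · exact h₂.inv_edge e

theorem pushout.faceMap_finv (g₁ : Hom Y Z₁) (g₂ : Hom Y Z₂) (h₁ : Hom Z₁ X) (h₂ : Hom Z₂ X)
    (H : h₁.comp g₁ = h₂.comp g₂) (σ : Quot (Glue g₁.face g₂.face)) :
    faceMap g₁ g₂ h₁ h₂ H (finv g₁ g₂ σ) = X.finv (faceMap g₁ g₂ h₁ h₂ H σ) := by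
  rcases σ with ⟨σ | σ⟩
  · exact h₁.face_finv σ
  · exact h₂.face_finv σ

/-- The `1`-skeleton of the pushout. -/
def pushout₁ (g₁ : Hom Y Z₁) (g₂ : Hom Y Z₂) (h₁ : Hom Z₁ X) (h₂ : Hom Z₂ X)
    (H : h₁.comp g₁ = h₂.comp g₂) : OneComplex.{u} where
  V := Quot (Glue g₁.vert g₂.vert)
  E := Quot (Glue g₁.edge g₂.edge)
  s := Quot.map (Sum.map Z₁.s Z₂.s) (by
    rintro _ _ ⟨a⟩
    change Glue _ _ (Sum.inl (Z₁.s _)) (Sum.inr (Z₂.s _))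
    rw [g₁.s_edge, g₂.s_edge]
    exact ⟨_⟩)
  inv := pushout.inv g₁ g₂
  inv_inv := by
    rintro ⟨e | e⟩
    · exact congrArg (fun x => Quot.mk _ (Sum.inl x)) (Z₁.inv_inv e)
    · exact congrArg (fun x => Quot.mk _ (Sum.inr x)) (Z₂.inv_inv e)
  inv_ne e he := X.inv_ne _
    ((pushout.edgeMap_inv g₁ g₂ h₁ h₂ H e).symm.trans (congrArg _ he))

variable {g₁ : Hom Y Z₁} {g₂ : Hom Y Z₂} {h₁ : Hom Z₁ X} {h₂ : Hom Z₂ X}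

/-- The quotient map on the `1`-skeleton of `Z₁`. -/
def pushout₁.inl (H : h₁.comp g₁ = h₂.comp g₂) :
    OneComplex.Hom Z₁.toOneComplex (pushout₁ g₁ g₂ h₁ h₂ H) where
  vert x := Quot.mk _ (Sum.inl x)
  edge x := Quot.mk _ (Sum.inl x)
  s_edge _ := rfl
  inv_edge _ := rfl

/-- The quotient map on the `1`-skeleton of `Z₂`. -/
def pushout₁.inr (H : h₁.comp g₁ = h₂.comp g₂) :
    OneComplex.Hom Z₂.toOneComplex (pushout₁ g₁ g₂ h₁ h₂ H) where
  vert x := Quot.mk _ (Sum.inr x)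
  edge x := Quot.mk _ (Sum.inr x)
  s_edge _ := rfl
  inv_edge _ := rfl

theorem pushout₁.condition (H : h₁.comp g₁ = h₂.comp g₂) :
    (pushout₁.inl H).comp g₁.toHom = (pushout₁.inr H).comp g₂.toHom :=
  OneComplex.Hom.ext (funext fun x => Quot.sound ⟨x⟩) (funext fun x => Quot.sound ⟨x⟩)

/-- The attaching map of the face `[σ]` of the pushout: `q ∘ att σ ∘ ε(hᵢ, σ)⁻¹` for a face
`σ` of `Zᵢ`, where `q` is the quotient map. -/
noncomputable def pushout.att (H : h₁.comp g₁ = h₂.comp g₂) (σ : Quot (Glue g₁.face g₂.face)) :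
    OneComplex.Hom (sphere (X.len (faceMap g₁ g₂ h₁ h₂ H σ))) (pushout₁ g₁ g₂ h₁ h₂ H) :=
  Quot.hrecOn (motive := fun σ => OneComplex.Hom (sphere (X.len (faceMap g₁ g₂ h₁ h₂ H σ)))
      (pushout₁ g₁ g₂ h₁ h₂ H)) σ
    (fun
      | Sum.inl σ => (pushout₁.inl H).comp ((Z₁.att σ).comp (h₁.ε σ).symm.toHom)
      | Sum.inr σ => (pushout₁.inr H).comp ((Z₂.att σ).comp (h₂.ε σ).symm.toHom))
    (by
      have heq : ∀ {n m : ℕ} (h : n = m) (a : OneComplex.Hom (sphere n) (pushout₁ g₁ g₂ h₁ h₂ H))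
          (b : OneComplex.Hom (sphere m) (pushout₁ g₁ g₂ h₁ h₂ H)),
          a = b.comp (SphereIso.cast h).toHom → a ≍ b := by
        rintro n _ rfl a b rfl
        rfl
      rintro _ _ ⟨y⟩
      have hl : X.len (h₁.face (g₁.face y)) = X.len (h₂.face (g₂.face y)) :=
        congrArg X.len (congrArg (fun k => Hom.face k y) H)
      refine heq hl _ _ ?_
      have k2 : (h₂.ε (g₂.face y)).symm.comp (SphereIso.cast hl) =
          (g₂.ε y).comp ((g₁.ε y).symm.comp (h₁.ε (g₁.face y)).symm) :=
        SphereIso.symm_comp_cast (Hom.ε_congr H y hl)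
      calc (pushout₁.inl H).comp ((Z₁.att _).comp (h₁.ε (g₁.face y)).symm.toHom)
          = (pushout₁.inl H).comp (((Z₁.att _).comp (g₁.ε y).toHom).comp
              ((g₁.ε y).symm.comp (h₁.ε (g₁.face y)).symm).toHom) :=
            congrArg (fun k => (pushout₁.inl H).comp ((Z₁.att _).comp (SphereIso.toHom k)))
              (SphereIso.comp_symm_cancel (g₁.ε y) (h₁.ε (g₁.face y)).symm).symm
        _ = (((pushout₁.inl H).comp g₁.toHom).comp (Y.att y)).comp
              ((g₁.ε y).symm.comp (h₁.ε (g₁.face y)).symm).toHom := by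
            rw [g₁.att_ε]; rfl
        _ = (pushout₁.inr H).comp (((Z₂.att _).comp (g₂.ε y).toHom).comp
              ((g₁.ε y).symm.comp (h₁.ε (g₁.face y)).symm).toHom) := by
            rw [pushout₁.condition, g₂.att_ε]; rfl
        _ = (pushout₁.inr H).comp ((Z₂.att _).comp
              ((h₂.ε (g₂.face y)).symm.comp (SphereIso.cast hl)).toHom) := by
            rw [k2]; rfl)

variable (g₁ g₂ h₁ h₂)

/-- The pushout of `g₁ : Y → Z₁` and `g₂ : Y → Z₂`: the quotient of the disjoint union of `Z₁` and
`Z₂` by the equivalence relation on cells generated by `g₁ y ∼ g₂ y`. The cells, the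
incidence maps and the inversions only depend on `g₁` and `g₂`. The given maps
`hᵢ : Zᵢ → X` with `h₁ ∘ g₁ = h₂ ∘ g₂` show that no edge or face is identified with its inverse and
that the attaching maps of equivalent faces agree in the quotient; as boundary sphere of the
class of a face `σ` of `Zᵢ` we take that of `hᵢ σ`, identified with that of `σ` by `ε(hᵢ, σ)`. -/
noncomputable def pushout (H : h₁.comp g₁ = h₂.comp g₂) : TwoComplex.{u} where
  toOneComplex := pushout₁ g₁ g₂ h₁ h₂ H
  F := Quot (Glue g₁.face g₂.face)
  finv := pushout.finv g₁ g₂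
  finv_finv := by
    rintro ⟨e | e⟩
    · exact congrArg (fun x => Quot.mk _ (Sum.inl x)) (Z₁.finv_finv e)
    · exact congrArg (fun x => Quot.mk _ (Sum.inr x)) (Z₂.finv_finv e)
  finv_ne e he := X.finv_ne _
    ((pushout.faceMap_finv g₁ g₂ h₁ h₂ H e).symm.trans (congrArg _ he))
  len σ := X.len (pushout.faceMap g₁ g₂ h₁ h₂ H σ)
  att σ := pushout.att H σ
  len_finv σ := (congrArg X.len (pushout.faceMap_finv g₁ g₂ h₁ h₂ H σ)).trans (X.len_finv _)
  att_finv := by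
    rintro ⟨σ | σ⟩
    · change (pushout₁.inl H).comp ((Z₁.att (Z₁.finv σ)).comp (h₁.ε (Z₁.finv σ)).symm.toHom) =
        ((pushout₁.inl H).comp ((Z₁.att σ).comp (h₁.ε σ).symm.toHom)).comp (reflect _)
      rw [Z₁.att_finv]
      exact congrArg (fun k => (pushout₁.inl H).comp ((Z₁.att σ).comp k)) (h₁.ε_finv_symm σ)
    · change (pushout₁.inr H).comp ((Z₂.att (Z₂.finv σ)).comp (h₂.ε (Z₂.finv σ)).symm.toHom) =
        ((pushout₁.inr H).comp ((Z₂.att σ).comp (h₂.ε σ).symm.toHom)).comp (reflect _)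
      rw [Z₂.att_finv]
      exact congrArg (fun k => (pushout₁.inr H).comp ((Z₂.att σ).comp k)) (h₂.ε_finv_symm σ)

variable {g₁ g₂ h₁ h₂}

/-- The map `t₁ : z ↦ [z]` from `Z₁` to the pushout. -/
noncomputable def pushout.inl (H : h₁.comp g₁ = h₂.comp g₂) :
    Hom Z₁ (pushout g₁ g₂ h₁ h₂ H) where
  toHom := pushout₁.inl H
  face σ := Quot.mk _ (Sum.inl σ)
  face_finv _ := rfl
  ε σ := h₁.ε σ
  att_ε σ := by
    change (pushout₁.inl H).comp ((Z₁.att σ).comp ((h₁.ε σ).symm.comp (h₁.ε σ)).toHom) = _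
    rw [SphereIso.symm_comp]
    rfl
  ε_finv σ := h₁.ε_finv σ

/-- The map `[z] ↦ hᵢ z` (for `z` in `Zᵢ`) from the pushout to `X`. -/
noncomputable def pushout.desc (H : h₁.comp g₁ = h₂.comp g₂) :
    Hom (pushout g₁ g₂ h₁ h₂ H) X where
  vert := Quot.lift (Sum.elim h₁.vert h₂.vert)
    (by rintro _ _ ⟨a⟩; exact congrArg (fun k : Hom Y X => k.vert a) H)
  edge := pushout.edgeMap g₁ g₂ h₁ h₂ H
  s_edge := by
    rintro ⟨e | e⟩
    · exact h₁.s_edge e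
    · exact h₂.s_edge e
  inv_edge := pushout.edgeMap_inv g₁ g₂ h₁ h₂ H
  face := pushout.faceMap g₁ g₂ h₁ h₂ H
  face_finv := pushout.faceMap_finv g₁ g₂ h₁ h₂ H
  ε _ := SphereIso.refl _
  att_ε := by
    rintro ⟨σ | σ⟩
    · exact (h₁.att_ε_symm σ).symm
    · exact (h₂.att_ε_symm σ).symm
  ε_finv _ := rfl

end Pushout

/-! ## Pointed intermediate coverings -/

/-- Factorisations `Y → Z → X` of `f : Y → X` into maps of pointed complexes, where `Y` is
pointed at `u`, `X` at `v = f u` and `Z` at `pt`. -/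
structure Factorisation {Y X : TwoComplex.{u}} (f : Hom Y X) (u : Y.V) where
  Z : TwoComplex.{u}
  pt : Z.V
  g : Hom Y Z
  h : Hom Z X
  g_pt : g.vert u = pt
  h_pt : h.vert pt = f.vert u
  comm : h.comp g = f

namespace Factorisation

variable {Y X : TwoComplex.{u}} {f : Hom Y X} {u : Y.V}

/-- `Y → Z → X` is a connected intermediate covering: `Z` is connected and both maps are
coverings. -/
structure IsIntermediateCovering (A : Factorisation f u) : Prop where
  connected : A.Z.Connected
  g_covering : A.g.IsCovering
  h_covering : A.h.IsCovering

/-- `Y → X → X`. -/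
def bottom (f : Hom Y X) (u : Y.V) : Factorisation f u where
  Z := X
  pt := f.vert u
  g := f
  h := Hom.id X
  g_pt := rfl
  h_pt := rfl
  comm := rfl

/-- `Y → Y → X`. -/
def top (f : Hom Y X) (u : Y.V) : Factorisation f u where
  Z := Y
  pt := u
  g := Hom.id Y
  h := f
  g_pt := rfl
  h_pt := rfl
  comm := rfl

/-- The pointed pullback over `X`: the connected component of the pullback of `h₁`, `h₂` that
contains the vertex `(z₁, z₂)`. -/
noncomputable def pullback (hY : Y.Connected) (A B : Factorisation f u) : Factorisation f u :=
  let p : (TwoComplex.pullback A.h B.h).V := ⟨(A.pt, B.pt), A.h_pt.trans B.h_pt.symm⟩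
  { Z := (TwoComplex.pullback A.h B.h).component p
    pt := ⟨p, Relation.ReflTransGen.refl⟩
    g := component.restrict hY (pullback.lift A.g B.g (A.comm.trans B.comm.symm)) u p
      (Subtype.ext (Prod.ext A.g_pt B.g_pt))
    h := (A.h.comp (pullback.fst A.h B.h)).comp (component.incl _ _)
    g_pt := Subtype.ext (Subtype.ext (Prod.ext A.g_pt B.g_pt))
    h_pt := A.h_pt
    comm := by
      refine Eq.trans (b := A.h.comp A.g) (Hom.ext_of (fun _ => rfl) (fun _ => rfl) (fun _ => rfl) fun σ => ?_) A.comm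
      exact SphereIso.comp_symm_cancel (A.h.ε (A.g.face σ)) ((A.h.comp A.g).ε σ) }

/-- The pointed pushout under `Y`: the pushout of `g₁`, `g₂`, pointed at `[z₁] = [z₂]`. -/
noncomputable def pushout (A B : Factorisation f u) : Factorisation f u where
  Z := TwoComplex.pushout A.g B.g A.h B.h (A.comm.trans B.comm.symm)
  pt := Quot.mk _ (Sum.inl A.pt)
  g := (pushout.inl _).comp A.g
  h := pushout.desc _
  g_pt := congrArg (fun x => Quot.mk _ (Sum.inl x)) A.g_pt
  h_pt := A.h_pt
  comm := Eq.trans rfl A.comm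

end Factorisation

/-- Pointed connected intermediate coverings `Y → Z → X` of `f : Y → X`. -/
def Intermediate {Y X : TwoComplex.{u}} (f : Hom Y X) (u : Y.V) : Type (u + 1) :=
  {A : Factorisation f u // A.IsIntermediateCovering}

namespace Intermediate

variable {Y X : TwoComplex.{u}} {f : Hom Y X} {u : Y.V}

/-- Two intermediate coverings are equivalent if there is an isomorphism `Z₁ → Z₂` that commutes
with the maps from `Y` and to `X` (hence also with the base points). -/
def Equivalent (A B : Intermediate f u) : Prop :=
  ∃ t : Hom A.1.Z B.1.Z, t.IsIso ∧ t.comp A.1.g = B.1.g ∧ B.1.h.comp t = A.1.h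

/-- `A ≤ B` if there is a covering `Z_B → Z_A` that commutes with the maps from `Y`
and to `X` (hence also with the base points). -/
def Le (A B : Intermediate f u) : Prop :=
  ∃ t : Hom B.1.Z A.1.Z, t.IsCovering ∧ t.comp B.1.g = A.1.g ∧ A.1.h.comp t = B.1.h

theorem Equivalent.symm {A B : Intermediate f u} : Equivalent A B → Equivalent B A := by
  rintro ⟨t, ht, h1, h2⟩
  obtain ⟨t', ht', k1, k2⟩ := ht.exists_inverse
  refine ⟨t', ht', ?_, ?_⟩
  · rw [← h1]
    change (t'.comp t).comp A.1.g = _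
    rw [k1]; rfl
  · rw [← h2]
    change B.1.h.comp (t.comp t') = _
    rw [k2]; rfl

theorem Equivalent.le {A B : Intermediate f u} : Equivalent A B → Le B A := by
  rintro ⟨t, ht, h1, h2⟩
  exact ⟨t, ht.isCovering, h1, h2⟩

theorem Le.trans {A B C : Intermediate f u} : Le A B → Le B C → Le A C := by
  rintro ⟨t, ht, h1, h2⟩ ⟨t', ht', k1, k2⟩
  refine ⟨t.comp t', ht.comp ht', ?_, ?_⟩
  · rw [← h1, ← k1]; rfl
  · rw [← k2, ← h2]; rfl

instance setoid (f : Hom Y X) (u : Y.V) : Setoid (Intermediate f u) where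
  r := Equivalent
  iseqv :=
    { refl := fun A => ⟨Hom.id _, Hom.isIso_id _, rfl, rfl⟩
      symm := Equivalent.symm
      trans := by
        rintro A B C ⟨t, ht, h1, h2⟩ ⟨t', ht', k1, k2⟩
        refine ⟨t'.comp t, ht'.comp ht, ?_, ?_⟩
        · rw [← k1, ← h1]; rfl
        · rw [← h2, ← k2]; rfl }

end Intermediate

/-- The set `ℒ(Y_u, X_v)`, `v = f u`, of equivalence classes of pointed connected
intermediate coverings of `f`. -/
def CoveringPoset {Y X : TwoComplex.{u}} (f : Hom Y X) (u : Y.V) : Type (u + 1) :=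
  Quotient (Intermediate.setoid f u)

namespace CoveringPoset

variable {Y X : TwoComplex.{u}} {f : Hom Y X} {u : Y.V}

/-- The equivalence class of an intermediate covering. -/
def mk (A : Factorisation f u) (hA : A.IsIntermediateCovering) : CoveringPoset f u :=
  Quotient.mk _ ⟨A, hA⟩

/-- The order on equivalence classes, defined on representatives: `a` is below `b` if `b`
covers `a`. -/
def Le : CoveringPoset f u → CoveringPoset f u → Prop :=
  Quotient.lift₂ Intermediate.Le fun _ _ _ _ hA hB =>
    propext ⟨fun h => (hA.le.trans h).trans hB.symm.le, fun h => (hA.symm.le.trans h).trans hB.le⟩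

end CoveringPoset

end TwoComplex

/-! A covering of a connected complex by a nonempty one is onto on cells, hence an epimorphism
(`IsCovering.cancel_right`). So a map between intermediate coverings is determined by its
compatibility with the maps from `Y`. Its compatibility with the maps to `X` is then automatic, and
it is itself a covering, because `h ∘ t` and `h` being coverings forces `t` to be one
(`IsCovering.of_comp`). The order therefore only asks for some map under `Y`
(`Intermediate.le_of_comp_g`), and antisymmetry, joins and meets become formal consequences of
universal properties.

What remains is that the two constructions give coverings. For this a face is replaced by its
corners, the pairs of a face and a vertex of its boundary sphere: a covering is a map that is
bijective on the edges and on the corners at each vertex (`isCovering_iff`). Projections of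
pullbacks are coverings by base change (`pullback.fst_isCovering`), and passing to a component
changes nothing locally. For pushouts the point is `exists_of_glue`: since the maps from `Y` lift
edges and corners, any edge or corner at a vertex `[x]` has a representative at `x` itself, so
locally the pushout over `X` looks like `Z₁` over `X` (`pushout.desc_isCovering`). -/

theorem OneComplex.Joined.symm {X : OneComplex.{u}} {x w : X.V} (h : X.Joined x w) :
    X.Joined w x := by
  induction h with
  | refl => exact Relation.ReflTransGen.refl
  | tail _ h ih =>
    obtain ⟨e, rfl, rfl⟩ := h
    exact Relation.ReflTransGen.head ⟨X.inv e, rfl, by rw [X.inv_inv]⟩ ih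

theorem OneComplex.Joined.trans {X : OneComplex.{u}} {x y z : X.V} (h : X.Joined x y)
    (h' : X.Joined y z) : X.Joined x z :=
  Relation.ReflTransGen.trans h h'

/-- Needed because a face belongs to a component only if its whole boundary does: one boundary
vertex in the component then suffices. -/
theorem sphere_connected (n : ℕ) : (sphere n).Connected := by
  have key : ∀ i (hi : i < n - 1 + 1), (sphere n).Joined ⟨0, by omega⟩ ⟨i, hi⟩ := by
    intro i
    induction i with
    | zero => exact fun _ => Relation.ReflTransGen.refl
    | succ i ih =>
      intro hi
      refine (ih (by omega)).tail ⟨(⟨i, by omega⟩, true), ?_, ?_⟩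
      · exact Fin.ext (Nat.mod_eq_of_lt (show i < n - 1 + 1 by omega))
      · exact Fin.ext (Nat.mod_eq_of_lt hi)
  exact fun x w => (key x.1 x.2).symm.trans (key w.1 w.2)

/-! ### Cancellation for isomorphisms of boundary spheres. -/

namespace SphereIso

theorem comp_right_cancel {n m k : ℕ} {a b : SphereIso m k} {c : SphereIso n m}
    (h : a.comp c = b.comp c) : a = b := by
  have := congrArg (fun d => d.comp c.symm) h
  simpa only [comp_assoc, comp_symm, comp_refl] using this

theorem comp_left_cancel {n m k : ℕ} {a b : SphereIso n m} {c : SphereIso m k}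
    (h : c.comp a = c.comp b) : a = b := by
  rw [← symm_comp_cancel c a, h, symm_comp_cancel]

theorem symm_vert_vert {n m : ℕ} (a : SphereIso n m) (i : (sphere n).V) :
    a.symm.vert (a.vert i) = i :=
  congrArg (fun d : SphereIso n n => d.vert i) a.symm_comp

end SphereIso

/-- A commutative square `ψ ∘ p = p' ∘ φ` is bijective on the fibres of `p` and `p'`. -/
def FibrewiseBijective {T V T' V' : Type*} (p : T → V) (p' : T' → V') (φ : T → T') (ψ : V → V') :
    Prop :=
  ∀ v t', p' t' = ψ v → ∃! t, p t = v ∧ φ t = t'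

/-- Passing to unique existence removes the subtypes, so that lifts can be handled as plain
elements. -/
theorem fibrewiseBijective_iff {T V T' V' : Type*} {p : T → V} {p' : T' → V'} {φ : T → T'}
    {ψ : V → V'} (hc : ∀ v, ∀ t : {t // p t = v}, p' (φ t.1) = ψ v) :
    FibrewiseBijective p p' φ ψ ↔ ∀ v, Function.Bijective
      (fun t : {t // p t = v} => (⟨φ t.1, hc v t⟩ : {t' // p' t' = ψ v})) := by
  refine forall_congr' fun v => ⟨fun h => ⟨?_, ?_⟩, fun h t' ht' => ?_⟩
  · intro a b hab
    obtain ⟨t, -, ht⟩ := h (φ a.1) (hc v a)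
    exact Subtype.ext ((ht a.1 ⟨a.2, rfl⟩).trans
      (ht b.1 ⟨b.2, (congrArg Subtype.val hab).symm⟩).symm)
  · intro t'
    obtain ⟨t, ht, -⟩ := h t'.1 t'.2
    exact ⟨⟨t, ht.1⟩, Subtype.ext ht.2⟩
  · obtain ⟨t, ht⟩ := h.2 ⟨t', ht'⟩
    refine ⟨t.1, ⟨t.2, congrArg Subtype.val ht⟩, fun s hs => ?_⟩
    have : (⟨s, hs.1⟩ : {t // p t = v}) = t :=
      h.1 (Subtype.ext (hs.2.trans (congrArg Subtype.val ht).symm))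
    exact congrArg Subtype.val this

/-! ### Corners, and coverings as fibrewise bijections. -/

namespace TwoComplex

/-- The corners of `X`: a face and a vertex of its boundary sphere. -/
abbrev Corner (X : TwoComplex.{u}) : Type u := Σ σ : X.F, (sphere (X.len σ)).V

/-- The vertex of `X` at a corner. -/
def Corner.vert {X : TwoComplex.{u}} (c : X.Corner) : X.V := (X.att c.1).vert c.2

/-- A map of complexes on corners. -/
def Hom.corner {X : TwoComplex.{u}} {Y : TwoComplex.{v}} (f : Hom X Y) (c : X.Corner) :
    Y.Corner :=
  ⟨f.face c.1, (f.ε c.1).vert c.2⟩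

/-- This is `att_ε` evaluated at a vertex. It makes corners over vertices formally the same as edges
over their start vertices. -/
theorem Hom.vert_corner {X : TwoComplex.{u}} {Y : TwoComplex.{v}} (f : Hom X Y)
    (c : X.Corner) : (f.corner c).vert = f.vert c.vert :=
  congrArg (fun k => OneComplex.Hom.vert k c.2) (f.att_ε c.1)

namespace Hom

section

variable {X : TwoComplex.{u}} {Y : TwoComplex.{v}} {Z : TwoComplex.{w}}

theorem isCovering_iff {f : Hom X Y} : f.IsCovering ↔
    FibrewiseBijective X.s Y.s f.edge f.vert ∧
      FibrewiseBijective Corner.vert Corner.vert f.corner f.vert := by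
  rw [fibrewiseBijective_iff (fun v t => by rw [f.s_edge, t.2]),
    fibrewiseBijective_iff (fun v t => by rw [f.vert_corner, t.2])]
  exact ⟨fun h => ⟨h.edge, h.face⟩, fun h => ⟨h.1, h.2⟩⟩

theorem IsCovering.exists_edge {f : Hom X Y} (hf : f.IsCovering) (x : X.V) (e : Y.E)
    (h : Y.s e = f.vert x) : ∃ d, X.s d = x ∧ f.edge d = e :=
  ((isCovering_iff.1 hf).1 x e h).exists

theorem IsCovering.exists_corner {f : Hom X Y} (hf : f.IsCovering) (x : X.V) (c : Y.Corner)
    (h : c.vert = f.vert x) : ∃ d : X.Corner, d.vert = x ∧ f.corner d = c :=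
  ((isCovering_iff.1 hf).2 x c h).exists

theorem IsCovering.edge_inj {f : Hom X Y} (hf : f.IsCovering) {d e : X.E}
    (hs : X.s d = X.s e) (h : f.edge d = f.edge e) : d = e :=
  ((isCovering_iff.1 hf).1 (X.s e) (f.edge e) (f.s_edge e)).unique ⟨hs, h⟩ ⟨rfl, rfl⟩

theorem IsCovering.corner_inj {f : Hom X Y} (hf : f.IsCovering) {c d : X.Corner}
    (hs : c.vert = d.vert) (h : f.corner c = f.corner d) : c = d :=
  ((isCovering_iff.1 hf).2 d.vert (f.corner d) (f.vert_corner d)).unique ⟨hs, h⟩ ⟨rfl, rfl⟩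

theorem isCovering_of {f : Hom X Y}
    (h1 : ∀ x e, Y.s e = f.vert x → ∃ d, X.s d = x ∧ f.edge d = e)
    (h2 : ∀ d e, X.s d = X.s e → f.edge d = f.edge e → d = e)
    (h3 : ∀ x (c : Y.Corner), c.vert = f.vert x → ∃ d : X.Corner, d.vert = x ∧ f.corner d = c)
    (h4 : ∀ c d : X.Corner, c.vert = d.vert → f.corner c = f.corner d → c = d) :
    f.IsCovering :=
  isCovering_iff.2 ⟨fun x e h => existsUnique_of_exists_of_unique (h1 x e h)
      fun _ _ a b => h2 _ _ (a.1.trans b.1.symm) (a.2.trans b.2.symm),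
    fun x c h => existsUnique_of_exists_of_unique (h3 x c h)
      fun _ _ a b => h4 _ _ (a.1.trans b.1.symm) (a.2.trans b.2.symm)⟩

theorem isCovering_id (X : TwoComplex.{u}) : (id X).IsCovering :=
  (isIso_id X).isCovering

/-- If `g ∘ f` and `g` are coverings then so is `f`. -/
theorem IsCovering.of_comp {g : Hom Y Z} {f : Hom X Y} (hg : g.IsCovering)
    (h : (g.comp f).IsCovering) : f.IsCovering :=
  -- The local maps of a composite are definitionally the composites of the local maps.
  ⟨fun x => ((hg.edge (f.vert x)).of_comp_iff' (f.localEdge x)).1 (h.edge x),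
    fun x => ((hg.face (f.vert x)).of_comp_iff' (f.localFace x)).1 (h.face x)⟩

/-- Path lifting: a path from `f x` to the target vertex is lifted edge by edge. The vertex `x`
rules out an empty source. -/
theorem IsCovering.vert_surjective {f : Hom X Y} (hf : f.IsCovering) (hY : Y.Connected) (x : X.V) :
    Function.Surjective f.vert := by
  intro y
  induction hY (f.vert x) y with
  | refl => exact ⟨x, rfl⟩
  | tail _ h ih =>
    obtain ⟨e, rfl, rfl⟩ := h
    obtain ⟨a, ha⟩ := ih
    obtain ⟨d, -, rfl⟩ := hf.exists_edge a e ha.symm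
    exact ⟨X.s (X.inv d), by rw [← f.s_edge, f.inv_edge]⟩

theorem IsCovering.edge_surjective {f : Hom X Y} (hf : f.IsCovering) (hY : Y.Connected) (x : X.V) :
    Function.Surjective f.edge := by
  intro e
  obtain ⟨a, ha⟩ := hf.vert_surjective hY x (Y.s e)
  obtain ⟨d, -, h⟩ := hf.exists_edge a e ha.symm
  exact ⟨d, h⟩

theorem IsCovering.face_surjective {f : Hom X Y} (hf : f.IsCovering) (hY : Y.Connected) (x : X.V) :
    Function.Surjective f.face := by
  intro τ
  -- Every boundary sphere has a vertex, also the one without arcs, so each face has a corner that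
  -- can be lifted.
  let c : Y.Corner := ⟨τ, 0⟩
  obtain ⟨a, ha⟩ := hf.vert_surjective hY x c.vert
  obtain ⟨d, -, h⟩ := hf.exists_corner a c ha.symm
  exact ⟨d.1, congrArg Sigma.fst h⟩

/-- A covering of a connected complex by a nonempty one is an epimorphism. -/
theorem IsCovering.cancel_right {f : Hom X Y} (hf : f.IsCovering) (hY : Y.Connected) (x : X.V)
    {a b : Hom Y Z} (h : a.comp f = b.comp f) : a = b := by
  refine ext_of (fun y => ?_) (fun y => ?_) (fun y => ?_) fun y => ?_
  · obtain ⟨y, rfl⟩ := hf.vert_surjective hY x y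
    exact congrArg (fun k : Hom X Z => k.vert y) h
  · obtain ⟨y, rfl⟩ := hf.edge_surjective hY x y
    exact congrArg (fun k : Hom X Z => k.edge y) h
  · obtain ⟨y, rfl⟩ := hf.face_surjective hY x y
    exact congrArg (fun k : Hom X Z => k.face y) h
  · obtain ⟨y, rfl⟩ := hf.face_surjective hY x y
    -- On a face `f y` the hypothesis compares `ε(a, f y) ∘ ε(f, y)` with `ε(b, f y) ∘ ε(f, y)`, and
    -- `ε(f, y)` is invertible.
    exact SphereIso.comp_right_cancel (c := f.ε y)
      (ε_congr h y (congrArg (fun k : Hom X Z => Z.len (k.face y)) h))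

/-- Maps that agree on cells and become equal after composition with some map are equal. -/
theorem ext_of_comp {a b : Hom X Y} (g : Hom Y Z) (h : g.comp a = g.comp b)
    (hv : ∀ x, a.vert x = b.vert x) (he : ∀ x, a.edge x = b.edge x)
    (hf : ∀ σ, a.face σ = b.face σ) : a = b := by
  refine ext_of hv he hf fun σ => ?_
  -- Once the two image faces are free variables their equality can be substituted; then `ε(g, τ)`
  -- cancels on the left.
  have key : ∀ {n : ℕ} {τ τ' : Y.F} (e : τ = τ') (hl : Z.len (g.face τ) = Z.len (g.face τ'))
      (c : SphereIso n (Y.len τ)) (d : SphereIso n (Y.len τ')),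
      (SphereIso.cast hl).comp ((g.ε τ).comp c) = (g.ε τ').comp d →
      (SphereIso.cast (congrArg Y.len e)).comp c = d := by
    rintro n τ _ rfl hl c d h
    exact SphereIso.comp_left_cancel h
  exact key (hf σ) _ _ _ (ε_congr h σ (by
    change Z.len (g.face (a.face σ)) = Z.len (g.face (b.face σ)); rw [hf σ]))

end

end Hom

/-! ### Components -/

theorem component_connected (X : TwoComplex.{u}) (x : X.V) : (X.component x).Connected := by
  have key : ∀ w (h : X.Joined x w),
      (X.component x).Joined ⟨x, Relation.ReflTransGen.refl⟩ ⟨w, h⟩ := by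
    intro w h
    induction h with
    | refl => exact Relation.ReflTransGen.refl
    | tail h1 h ih =>
      obtain ⟨e, rfl, rfl⟩ := h
      exact ih.tail ⟨⟨e, h1⟩, rfl, rfl⟩
  exact fun a b => (key a.1 a.2).symm.trans (key b.1 b.2)

theorem component.incl_isCovering (X : TwoComplex.{u}) (x : X.V) :
    (component.incl X x).IsCovering := by
  refine Hom.isCovering_of ?_ ?_ ?_ ?_
  · rintro a e h
    exact ⟨⟨e, h ▸ a.2⟩, Subtype.ext h, rfl⟩
  · exact fun d e _ h => Subtype.ext h
  · rintro a ⟨σ, i⟩ h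
    -- The attaching map carries paths of the sphere to paths of `X`, so the vertex `i` drags the
    -- whole boundary into the component.
    exact ⟨⟨⟨σ, fun j => (show X.Joined x ((X.att σ).vert i) from
      (show (X.att σ).vert i = a.1 from h) ▸ a.2).trans
        ((X.att σ).joined (sphere_connected _ i j))⟩, i⟩, Subtype.ext h, rfl⟩
  · rintro ⟨⟨σ, hσ⟩, i⟩ ⟨⟨τ, hτ⟩, j⟩ _ h
    obtain rfl : σ = τ := congrArg Sigma.fst h
    obtain rfl : i = j := eq_of_heq (Sigma.mk.inj h).2
    rfl

/-- The inclusion is injective on cells, and the isomorphisms of spheres are handled by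
`ext_of_comp`. -/
theorem component.hom_ext {Y X : TwoComplex.{u}} {x : X.V} {a b : Hom Y (X.component x)}
    (h : (component.incl X x).comp a = (component.incl X x).comp b) : a = b :=
  Hom.ext_of_comp _ h
    (fun z => Subtype.ext (congrArg (fun k : Hom Y X => k.vert z) h))
    (fun z => Subtype.ext (congrArg (fun k : Hom Y X => k.edge z) h))
    (fun z => Subtype.ext (congrArg (fun k : Hom Y X => k.face z) h))

/-! ### Pullbacks -/

section Pullback

variable {Y Z₁ Z₂ X : TwoComplex.{u}}

/-- The projection of the pullback to `Z₂`. -/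
noncomputable def pullback.snd (h₁ : Hom Z₁ X) (h₂ : Hom Z₂ X) : Hom (pullback h₁ h₂) Z₂ where
  vert p := p.1.2
  edge p := p.1.2
  s_edge _ := rfl
  inv_edge _ := rfl
  face σ := σ.1.2
  face_finv _ := rfl
  ε σ := (h₂.ε σ.1.2).symm.comp (SphereIso.cast (congrArg X.len σ.2))
  att_ε _ := rfl
  ε_finv σ := by
    -- Sphere lengths are measured through `h₁` but `h₂.ε` needs them through `h₂`; with free
    -- lengths the resulting casts can be eliminated.
    have key : ∀ (n m : ℕ) (hn : n = X.len (h₂.face (Z₂.finv σ.1.2)))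
        (hm : m = X.len (h₂.face σ.1.2)) (hnm : n = m),
        (reflect (Z₂.len_finv σ.1.2)).comp
          ((h₂.ε (Z₂.finv σ.1.2)).symm.comp (SphereIso.cast hn)).toHom =
        ((h₂.ε σ.1.2).symm.comp (SphereIso.cast hm)).toHom.comp (reflect hnm) := by
      rintro n m rfl hm rfl
      refine (h₂.ε_finv_symm σ.1.2).trans ?_
      change _ = (h₂.ε σ.1.2).symm.toHom.comp ((SphereIso.cast hm).toHom.comp (reflect rfl))
      rw [cast_comp_reflect]
    exact key _ _ _ _ _

theorem pullback.condition (h₁ : Hom Z₁ X) (h₂ : Hom Z₂ X) :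
    h₁.comp (pullback.fst h₁ h₂) = h₂.comp (pullback.snd h₁ h₂) := by
  refine Hom.ext_of (fun p => p.2) (fun p => p.2) (fun p => p.2) fun σ => ?_
  exact (congrArg (SphereIso.comp (SphereIso.cast (congrArg X.len σ.2)))
    (SphereIso.comp_symm (h₁.ε σ.1.1))).trans
      (SphereIso.comp_symm_cancel (h₂.ε σ.1.2) (SphereIso.cast (congrArg X.len σ.2))).symm

theorem pullback.fst_comp_lift {h₁ : Hom Z₁ X} {h₂ : Hom Z₂ X} (g₁ : Hom Y Z₁) (g₂ : Hom Y Z₂)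
    (H : h₁.comp g₁ = h₂.comp g₂) : (pullback.fst h₁ h₂).comp (pullback.lift g₁ g₂ H) = g₁ :=
  Hom.ext_of (fun _ => rfl) (fun _ => rfl) (fun _ => rfl)
    fun σ => SphereIso.symm_comp_cancel (h₁.ε (g₁.face σ)) (g₁.ε σ)

theorem pullback.snd_comp_lift {h₁ : Hom Z₁ X} {h₂ : Hom Z₂ X} (g₁ : Hom Y Z₁) (g₂ : Hom Y Z₂)
    (H : h₁.comp g₁ = h₂.comp g₂) : (pullback.snd h₁ h₂).comp (pullback.lift g₁ g₂ H) = g₂ := by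
  -- On cells the two maps agree by definition. The casts in `snd` are avoided by comparing after
  -- `h₂`, where commutativity of the square reduces the claim to `fst`.
  refine Hom.ext_of_comp h₂ ?_ (fun _ => rfl) (fun _ => rfl) (fun _ => rfl)
  change (h₂.comp (pullback.snd h₁ h₂)).comp (pullback.lift g₁ g₂ H) = _
  rw [← pullback.condition, ← H]
  exact congrArg (Hom.comp h₁) (pullback.fst_comp_lift g₁ g₂ H)

theorem pullback.hom_ext {h₁ : Hom Z₁ X} {h₂ : Hom Z₂ X} {a b : Hom Y (pullback h₁ h₂)}
    (e₁ : (pullback.fst h₁ h₂).comp a = (pullback.fst h₁ h₂).comp b)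
    (e₂ : (pullback.snd h₁ h₂).comp a = (pullback.snd h₁ h₂).comp b) : a = b :=
  Hom.ext_of_comp _ e₁
    (fun z => Subtype.ext (Prod.ext (congrArg (fun k : Hom Y Z₁ => k.vert z) e₁)
      (congrArg (fun k : Hom Y Z₂ => k.vert z) e₂)))
    (fun z => Subtype.ext (Prod.ext (congrArg (fun k : Hom Y Z₁ => k.edge z) e₁)
      (congrArg (fun k : Hom Y Z₂ => k.edge z) e₂)))
    (fun z => Subtype.ext (Prod.ext (congrArg (fun k : Hom Y Z₁ => k.face z) e₁)
      (congrArg (fun k : Hom Y Z₂ => k.face z) e₂)))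

/-- Together with `pullback.corner_ext` this identifies the corners of the pullback with the fibre
product of the corners, just as for vertices and edges. -/
theorem pullback.exists_corner {h₁ : Hom Z₁ X} {h₂ : Hom Z₂ X} (c₁ : Z₁.Corner) (c₂ : Z₂.Corner)
    (h : h₁.corner c₁ = h₂.corner c₂) : ∃ c : (pullback h₁ h₂).Corner,
      (pullback.fst h₁ h₂).corner c = c₁ ∧ (pullback.snd h₁ h₂).corner c = c₂ := by
  obtain ⟨σ₁, i₁⟩ := c₁
  obtain ⟨σ₂, i₂⟩ := c₂
  obtain ⟨hσ, hi⟩ := Sigma.mk.inj h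
  have cast_eq : ∀ {n m : ℕ} (e : n = m) (i : (sphere n).V) (j : (sphere m).V), i ≍ j →
      (SphereIso.cast e).vert i = j := by
    rintro n _ rfl i j h
    exact eq_of_heq h
  -- The boundary sphere of `σ₁ × σ₂` is that of the image in `X`, so the vertex is the common image
  -- of `i₁` and `i₂` there.
  refine ⟨⟨⟨(σ₁, σ₂), hσ⟩, (h₁.ε σ₁).vert i₁⟩, ?_, ?_⟩
  · exact congrArg (Sigma.mk σ₁) ((h₁.ε σ₁).symm_vert_vert i₁)
  · exact congrArg (Sigma.mk σ₂) ((congrArg (h₂.ε σ₂).symm.vert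
      (cast_eq (congrArg X.len hσ) _ _ hi)).trans ((h₂.ε σ₂).symm_vert_vert i₂))

theorem pullback.corner_ext {h₁ : Hom Z₁ X} {h₂ : Hom Z₂ X} {c d : (pullback h₁ h₂).Corner}
    (e₁ : (pullback.fst h₁ h₂).corner c = (pullback.fst h₁ h₂).corner d)
    (e₂ : (pullback.snd h₁ h₂).corner c = (pullback.snd h₁ h₂).corner d) : c = d := by
  obtain ⟨σ, i⟩ := c
  obtain ⟨τ, j⟩ := d
  obtain rfl : σ = τ :=
    Subtype.ext (Prod.ext (congrArg Sigma.fst e₁) (congrArg Sigma.fst e₂))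
  obtain rfl : i = j := (h₁.ε σ.1.1).symm.vert_bijective.1 (eq_of_heq (Sigma.mk.inj e₁).2)
  rfl

theorem pullback.vert_ext {h₁ : Hom Z₁ X} {h₂ : Hom Z₂ X} {x y : (pullback h₁ h₂).V}
    (e₁ : (pullback.fst h₁ h₂).vert x = (pullback.fst h₁ h₂).vert y)
    (e₂ : (pullback.snd h₁ h₂).vert x = (pullback.snd h₁ h₂).vert y) : x = y :=
  Subtype.ext (Prod.ext e₁ e₂)

theorem pullback.corner_condition (h₁ : Hom Z₁ X) (h₂ : Hom Z₂ X) (c : (pullback h₁ h₂).Corner) :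
    h₁.corner ((pullback.fst h₁ h₂).corner c) = h₂.corner ((pullback.snd h₁ h₂).corner c) :=
  congrArg (fun k => Hom.corner k c) (pullback.condition h₁ h₂)

/-- Base change: an edge or corner at `x₁` acquires its second coordinate as the unique lift along
`h₂`, at `x₂`, of its image in `X`. -/
theorem pullback.fst_isCovering {h₁ : Hom Z₁ X} {h₂ : Hom Z₂ X} (k₂ : h₂.IsCovering) :
    (pullback.fst h₁ h₂).IsCovering := by
  refine Hom.isCovering_of ?_ ?_ ?_ ?_
  · rintro ⟨⟨x₁, x₂⟩, hx⟩ e (rfl : Z₁.s e = x₁)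
    obtain ⟨d, rfl, hd⟩ := k₂.exists_edge x₂ (h₁.edge e) ((h₁.s_edge e).trans hx)
    exact ⟨⟨(e, d), hd.symm⟩, rfl, rfl⟩
  · intro d e hs h
    refine Subtype.ext (Prod.ext h (k₂.edge_inj (congrArg (fun p => p.1.2) hs) ?_))
    exact d.2.symm.trans ((congrArg h₁.edge h).trans e.2)
  · rintro x c₁ hc
    have h2 : (h₁.corner c₁).vert = h₂.vert x.1.2 := by
      rw [h₁.vert_corner, hc]; exact x.2
    obtain ⟨c₂, hv, hc₂⟩ := k₂.exists_corner x.1.2 (h₁.corner c₁) h2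
    obtain ⟨c, rfl, rfl⟩ := pullback.exists_corner c₁ c₂ hc₂.symm
    rw [Hom.vert_corner] at hc hv
    exact ⟨c, pullback.vert_ext hc hv, rfl⟩
  · intro c d hv h
    refine pullback.corner_ext h (k₂.corner_inj ?_ ?_)
    · rw [Hom.vert_corner, Hom.vert_corner, hv]
    · rw [← pullback.corner_condition, ← pullback.corner_condition, h]

end Pullback

/-! ### Pushouts -/

section Pushout

variable {Y Z₁ Z₂ X W : TwoComplex.{u}} {g₁ : Hom Y Z₁} {g₂ : Hom Y Z₂} {h₁ : Hom Z₁ X}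
  {h₂ : Hom Z₂ X}

/-- The map from `Z₂` to the pushout. -/
noncomputable def pushout.inr (H : h₁.comp g₁ = h₂.comp g₂) :
    Hom Z₂ (pushout g₁ g₂ h₁ h₂ H) where
  toHom := pushout₁.inr H
  face σ := Quot.mk _ (Sum.inr σ)
  face_finv _ := rfl
  ε σ := h₂.ε σ
  att_ε σ := by
    change (pushout₁.inr H).comp ((Z₂.att σ).comp ((h₂.ε σ).symm.comp (h₂.ε σ)).toHom) = _
    rw [SphereIso.symm_comp]
    rfl
  ε_finv σ := h₂.ε_finv σ

/-- On cells this is the gluing relation. For the isomorphisms of spheres one composes with `desc`,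
which turns the claim into `H`. -/
theorem pushout.condition (H : h₁.comp g₁ = h₂.comp g₂) :
    (pushout.inl H).comp g₁ = (pushout.inr H).comp g₂ :=
  Hom.ext_of_comp (pushout.desc H) H (fun x => Quot.sound ⟨x⟩) (fun x => Quot.sound ⟨x⟩)
    (fun x => Quot.sound ⟨x⟩)

theorem pushout.corner_condition (H : h₁.comp g₁ = h₂.comp g₂) (c : Y.Corner) :
    (pushout.inl H).corner (g₁.corner c) = (pushout.inr H).corner (g₂.corner c) :=
  congrArg (fun k => Hom.corner k c) (pushout.condition H)

theorem pushout.exists_corner (H : h₁.comp g₁ = h₂.comp g₂) (c : (pushout g₁ g₂ h₁ h₂ H).Corner) :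
    (∃ d, (pushout.inl H).corner d = c) ∨ ∃ d, (pushout.inr H).corner d = c := by
  obtain ⟨⟨σ | σ⟩, i⟩ := c
  · obtain ⟨j, rfl⟩ := (h₁.ε σ).vert_bijective.2 i
    exact Or.inl ⟨⟨σ, j⟩, rfl⟩
  · obtain ⟨j, rfl⟩ := (h₂.ε σ).vert_bijective.2 i
    exact Or.inr ⟨⟨σ, j⟩, rfl⟩

/-- If fibrewise bijective squares `T → T₁`, `T → T₂` are glued, every element of the
glued total space lies over a given representative of its base point. -/
theorem exists_of_glue {V V₁ V₂ : Type u} {T T₁ T₂ Q : Type*} {b₁ : V → V₁} {b₂ : V → V₂}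
    {p : T → V} {p₁ : T₁ → V₁} {p₂ : T₂ → V₂} {t₁ : T → T₁} {t₂ : T → T₂}
    (c₁ : ∀ t, p₁ (t₁ t) = b₁ (p t)) (c₂ : ∀ t, p₂ (t₂ t) = b₂ (p t))
    (s₁ : ∀ v t, p₁ t = b₁ v → ∃ r, p r = v ∧ t₁ r = t)
    (s₂ : ∀ v t, p₂ t = b₂ v → ∃ r, p r = v ∧ t₂ r = t)
    {q₁ : T₁ → Q} {q₂ : T₂ → Q} (hq : ∀ t, q₁ (t₁ t) = q₂ (t₂ t)) {x y : V₁ ⊕ V₂}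
    (h : Quot.mk (Glue b₁ b₂) x = Quot.mk (Glue b₁ b₂) y) {a : Q}
    (ha : ∃ t, Sum.map p₁ p₂ t = x ∧ Sum.elim q₁ q₂ t = a) :
    ∃ t, Sum.map p₁ p₂ t = y ∧ Sum.elim q₁ q₂ t = a := by
  -- Having a representative of `a` over a point is invariant under each generating relation, so it
  -- is a predicate on the quotient and chains of relations need not be examined.
  let S : Quot (Glue b₁ b₂) → Prop :=
    Quot.lift (fun x => ∃ t, Sum.map p₁ p₂ t = x ∧ Sum.elim q₁ q₂ t = a) (by
      rintro _ _ ⟨v⟩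
      apply propext
      constructor
      · rintro ⟨t | t, h1, rfl⟩
        -- An element over `b₁ v` is lifted to one over `v` and pushed to the other side, which does
        -- not change its class in `Q`.
        · obtain ⟨r, rfl, rfl⟩ := s₁ v t (Sum.inl_injective h1)
          exact ⟨Sum.inr (t₂ r), congrArg Sum.inr (c₂ r), (hq r).symm⟩
        · cases h1
      · rintro ⟨t | t, h1, rfl⟩
        · cases h1
        · obtain ⟨r, rfl, rfl⟩ := s₂ v t (Sum.inr_injective h1)
          exact ⟨Sum.inl (t₁ r), congrArg Sum.inl (c₁ r), hq r⟩)
  exact (congrArg S h).mp ha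

/-- A priori an edge at `[x]` is represented only at some vertex equivalent to `x`. Lifting to `Y`
transports the representative to `x`. -/
theorem pushout.exists_edge_of_s_eq (H : h₁.comp g₁ = h₂.comp g₂) (k₁ : g₁.IsCovering)
    (k₂ : g₂.IsCovering) {x : Z₁.V} {e : (pushout g₁ g₂ h₁ h₂ H).E}
    (h : (pushout g₁ g₂ h₁ h₂ H).s e = (pushout.inl H).vert x) :
    ∃ d, Z₁.s d = x ∧ (pushout.inl H).edge d = e := by
  obtain ⟨e⟩ := e
  have := exists_of_glue (p := Y.s) (q₁ := (pushout.inl H).edge) (q₂ := (pushout.inr H).edge)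
    g₁.s_edge g₂.s_edge (fun _ _ => k₁.exists_edge _ _) (fun _ _ => k₂.exists_edge _ _)
    (fun t => congrArg (fun k => k.edge t) (pushout₁.condition H))
    (x := Sum.map Z₁.s Z₂.s e) (y := Sum.inl x) h (a := Quot.mk _ e)
    ⟨e, rfl, by cases e <;> rfl⟩
  obtain ⟨d | d, hd, h'⟩ := this
  · exact ⟨d, Sum.inl_injective hd, h'⟩
  · cases hd

theorem pushout.exists_corner_of_vert_eq (H : h₁.comp g₁ = h₂.comp g₂) (k₁ : g₁.IsCovering)
    (k₂ : g₂.IsCovering) {x : Z₁.V} {c : (pushout g₁ g₂ h₁ h₂ H).Corner}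
    (h : c.vert = (pushout.inl H).vert x) :
    ∃ d : Z₁.Corner, d.vert = x ∧ (pushout.inl H).corner d = c := by
  obtain ⟨y, hy, hc⟩ : ∃ y : Z₁.Corner ⊕ Z₂.Corner,
      c.vert = Quot.mk _ (Sum.map Corner.vert Corner.vert y) ∧
        Sum.elim (pushout.inl H).corner (pushout.inr H).corner y = c := by
    obtain ⟨d, rfl⟩ | ⟨d, rfl⟩ := pushout.exists_corner H c
    · exact ⟨Sum.inl d, Hom.vert_corner _ _, rfl⟩
    · exact ⟨Sum.inr d, Hom.vert_corner _ _, rfl⟩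
  have := exists_of_glue (p := Corner.vert) (q₁ := (pushout.inl H).corner)
    (q₂ := (pushout.inr H).corner) g₁.vert_corner g₂.vert_corner
    (fun _ _ => k₁.exists_corner _ _) (fun _ _ => k₂.exists_corner _ _)
    (pushout.corner_condition H) (y := Sum.inl x) (hy.symm.trans h) ⟨y, rfl, hc⟩
  obtain ⟨d | d, hd, h'⟩ := this
  · exact ⟨d, Sum.inl_injective hd, h'⟩
  · cases hd

/-- Every vertex is `[x]` with `x` in `Z₁`, and all edges and corners at `[x]` come from `x`.
Existence and uniqueness of lifts are thus inherited from `h₁`. -/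
theorem pushout.desc_isCovering (H : h₁.comp g₁ = h₂.comp g₂) (k₁ : g₁.IsCovering)
    (k₂ : g₂.IsCovering) (l₁ : h₁.IsCovering)
    (hs : Function.Surjective (pushout.inl H).vert) : (pushout.desc H).IsCovering := by
  refine Hom.isCovering_of ?_ ?_ ?_ ?_
  · intro x e h
    obtain ⟨x, rfl⟩ := hs x
    obtain ⟨d, rfl, rfl⟩ := l₁.exists_edge x e h
    exact ⟨(pushout.inl H).edge d, rfl, rfl⟩
  · intro d e he h
    obtain ⟨x, hx⟩ := hs ((pushout g₁ g₂ h₁ h₂ H).s e)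
    obtain ⟨d, hd, rfl⟩ := exists_edge_of_s_eq H k₁ k₂ (he.trans hx.symm)
    obtain ⟨e, rfl, rfl⟩ := exists_edge_of_s_eq H k₁ k₂ hx.symm
    exact congrArg _ (l₁.edge_inj hd h)
  · intro x c h
    obtain ⟨x, rfl⟩ := hs x
    obtain ⟨d, rfl, rfl⟩ := l₁.exists_corner x c h
    exact ⟨(pushout.inl H).corner d, Hom.vert_corner _ _, rfl⟩
  · intro c d hv h
    obtain ⟨x, hx⟩ := hs d.vert
    obtain ⟨c, hc, rfl⟩ := exists_corner_of_vert_eq H k₁ k₂ (hv.trans hx.symm)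
    obtain ⟨d, rfl, rfl⟩ := exists_corner_of_vert_eq H k₁ k₂ hx.symm
    exact congrArg _ (l₁.corner_inj hc h)

theorem pushout.inl_vert_surjective (H : h₁.comp g₁ = h₂.comp g₂)
    (hs : Function.Surjective g₂.vert) : Function.Surjective (pushout.inl H).vert := by
  rintro ⟨x | x⟩
  · exact ⟨x, rfl⟩
  · obtain ⟨y, rfl⟩ := hs x
    exact ⟨g₁.vert y, Quot.sound ⟨y⟩⟩

/-- Compatible maps `Zᵢ → W` over `X` induce a map from the pushout to `W`. -/
theorem pushout.exists_lift (H : h₁.comp g₁ = h₂.comp g₂) (k : Hom W X) (t₁ : Hom Z₁ W)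
    (t₂ : Hom Z₂ W) (ht : t₁.comp g₁ = t₂.comp g₂) (e₁ : k.comp t₁ = h₁) (e₂ : k.comp t₂ = h₂) :
    ∃ t : Hom (pushout g₁ g₂ h₁ h₂ H) W, t.comp (pushout.inl H) = t₁ := by
  subst e₁ e₂
  let fm : Quot (Glue g₁.face g₂.face) → W.F := pushout.faceMap g₁ g₂ t₁ t₂ ht
  have hfm : ∀ σ, pushout.faceMap g₁ g₂ (k.comp t₁) (k.comp t₂) H σ = k.face (fm σ) := by
    rintro ⟨σ | σ⟩ <;> rfl
  have hatt : ∀ {Z : TwoComplex.{u}} (t : Hom Z W) (σ : Z.F),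
      (W.att (t.face σ)).comp (k.ε (t.face σ)).symm.toHom =
        t.toHom.comp ((Z.att σ).comp ((k.comp t).ε σ).symm.toHom) := by
    intro Z t σ
    have e : (t.ε σ).comp ((k.comp t).ε σ).symm = (k.ε (t.face σ)).symm :=
      SphereIso.comp_left_cancel (c := k.ε (t.face σ))
        ((SphereIso.comp_symm ((k.comp t).ε σ)).trans (SphereIso.comp_symm _).symm)
    rw [← e]
    exact congrArg (fun a => a.comp ((k.comp t).ε σ).symm.toHom) (t.att_ε σ)
  have hrefl : ∀ (τ τ' : W.F) (_ : τ' = W.finv τ)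
      (a : X.len (k.face τ') = X.len (k.face τ)) (b : W.len τ' = W.len τ),
      (reflect b).comp (k.ε τ').symm.toHom = (k.ε τ).symm.toHom.comp (reflect a) := by
    rintro τ _ rfl a b
    exact k.ε_finv_symm τ
  let t : Hom (pushout g₁ g₂ (k.comp t₁) (k.comp t₂) H) W :=
    { vert := Quot.lift (Sum.elim t₁.vert t₂.vert)
        (by rintro _ _ ⟨a⟩; exact congrArg (fun k : Hom Y W => k.vert a) ht)
      edge := pushout.edgeMap g₁ g₂ t₁ t₂ ht
      s_edge := by
        rintro ⟨e | e⟩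
        · exact t₁.s_edge e
        · exact t₂.s_edge e
      inv_edge := pushout.edgeMap_inv g₁ g₂ t₁ t₂ ht
      face := fm
      face_finv := pushout.faceMap_finv g₁ g₂ t₁ t₂ ht
      -- This choice is forced: `k ∘ t` should be `desc`, whose isomorphisms of spheres are
      -- identities.
      ε := fun σ => (k.ε (fm σ)).symm.comp (SphereIso.cast (congrArg X.len (hfm σ)))
      att_ε := by
        rintro ⟨σ | σ⟩
        · exact hatt t₁ σ
        · exact hatt t₂ σ
      ε_finv := by
        rintro ⟨σ | σ⟩
        · exact hrefl _ _ (t₁.face_finv σ) _ _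
        · exact hrefl _ _ (t₂.face_finv σ) _ _ }
  exact ⟨t, Hom.ext_of (fun _ => rfl) (fun _ => rfl) (fun _ => rfl)
    fun _ => SphereIso.symm_comp_cancel _ _⟩

end Pushout

/-! ### Joins and meets of intermediate coverings -/

namespace Factorisation

variable {Y X : TwoComplex.{u}} {f : Hom Y X} {u : Y.V}

theorem bottom_isIntermediateCovering (hX : X.Connected) (hf : f.IsCovering) :
    (bottom f u).IsIntermediateCovering :=
  ⟨hX, hf, Hom.isCovering_id X⟩

theorem top_isIntermediateCovering (hY : Y.Connected) (hf : f.IsCovering) :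
    (top f u).IsIntermediateCovering :=
  ⟨hY, Hom.isCovering_id Y, hf⟩

/-- Since `h ∘ g = f`, the map `g` is a covering as soon as `h` is. -/
theorem isIntermediateCovering_of_h (hf : f.IsCovering) {A : Factorisation f u}
    (hA : A.Z.Connected) (h : A.h.IsCovering) : A.IsIntermediateCovering :=
  ⟨hA, h.of_comp (A.comm.symm ▸ hf), h⟩

variable {A B : Factorisation f u}

theorem pullback_isIntermediateCovering (hY : Y.Connected) (hf : f.IsCovering)
    (hA : A.IsIntermediateCovering) (hB : B.IsIntermediateCovering) :
    (pullback hY A B).IsIntermediateCovering :=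
  isIntermediateCovering_of_h hf (component_connected _ _)
    ((hA.h_covering.comp (pullback.fst_isCovering hB.h_covering)).comp
      (component.incl_isCovering _ _))

theorem pushout_isIntermediateCovering (hf : f.IsCovering)
    (hA : A.IsIntermediateCovering) (hB : B.IsIntermediateCovering) :
    (pushout A B).IsIntermediateCovering := by
  have hs : Function.Surjective (TwoComplex.pushout.inl (A.comm.trans B.comm.symm)).vert :=
    TwoComplex.pushout.inl_vert_surjective _ (hB.g_covering.vert_surjective hB.connected u)
  refine isIntermediateCovering_of_h hf (fun x y => ?_)
    (TwoComplex.pushout.desc_isCovering _ hA.g_covering hB.g_covering hA.h_covering hs)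
  obtain ⟨x, rfl⟩ := hs x
  obtain ⟨y, rfl⟩ := hs y
  -- All vertices come from the connected complex `A.Z`, so paths there can be pushed forward.
  exact (TwoComplex.pushout.inl _).joined (hA.connected x y)

end Factorisation

/-! ### The order on representatives and its universal properties. -/

namespace Intermediate

variable {Y X : TwoComplex.{u}} {f : Hom Y X} {u : Y.V}

theorem hom_ext (A : Intermediate f u) {W : TwoComplex.{u}} {a b : Hom A.1.Z W}
    (h : a.comp A.1.g = b.comp A.1.g) : a = b :=
  A.2.g_covering.cancel_right A.2.connected u h

/-- Both `A.h ∘ t` and `B.h` become `f` after the epimorphism `B.g`, so they coincide; then `t` is a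
covering because `A.h` and `B.h` are. -/
theorem le_of_comp_g {A B : Intermediate f u} (t : Hom B.1.Z A.1.Z)
    (h : t.comp B.1.g = A.1.g) : Le A B := by
  have e : A.1.h.comp t = B.1.h := by
    refine B.hom_ext (Eq.trans ?_ B.1.comm.symm)
    change A.1.h.comp (t.comp B.1.g) = f
    rw [h, A.1.comm]
  exact ⟨t, A.2.h_covering.of_comp (e.symm ▸ B.2.h_covering), h, e⟩

/-- Both composites fix the maps from `Y`, which are epimorphisms, so they are identities. -/
theorem Le.antisymm {A B : Intermediate f u} : Le A B → Le B A → Equivalent A B := by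
  rintro ⟨t, -, h1, -⟩ ⟨t', -, k1, k2⟩
  have e1 : t.comp t' = Hom.id _ := A.hom_ext (by
    change t.comp (t'.comp A.1.g) = A.1.g
    rw [k1, h1])
  have e2 : t'.comp t = Hom.id _ := B.hom_ext (by
    change t'.comp (t.comp B.1.g) = B.1.g
    rw [h1, k1])
  refine ⟨t', ⟨?_, ?_, ?_⟩, k1, k2⟩
  · exact Function.bijective_iff_has_inverse.2 ⟨t.vert,
      fun x => congrArg (fun k : Hom A.1.Z A.1.Z => k.vert x) e1,
      fun x => congrArg (fun k : Hom B.1.Z B.1.Z => k.vert x) e2⟩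
  · exact Function.bijective_iff_has_inverse.2 ⟨t.edge,
      fun x => congrArg (fun k : Hom A.1.Z A.1.Z => k.edge x) e1,
      fun x => congrArg (fun k : Hom B.1.Z B.1.Z => k.edge x) e2⟩
  · exact Function.bijective_iff_has_inverse.2 ⟨t.face,
      fun x => congrArg (fun k : Hom A.1.Z A.1.Z => k.face x) e1,
      fun x => congrArg (fun k : Hom B.1.Z B.1.Z => k.face x) e2⟩

/-- The join: the pointed pullback. -/
noncomputable def join (hY : Y.Connected) (hf : f.IsCovering) (A B : Intermediate f u) :
    Intermediate f u :=
  ⟨_, Factorisation.pullback_isIntermediateCovering hY hf A.2 B.2⟩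

/-- The meet: the pointed pushout. -/
noncomputable def meet (hf : f.IsCovering) (A B : Intermediate f u) :
    Intermediate f u :=
  ⟨_, Factorisation.pushout_isIntermediateCovering hf A.2 B.2⟩

theorem le_join_left (hY : Y.Connected) (hf : f.IsCovering) (A B : Intermediate f u) :
    Le A (join hY hf A B) :=
  le_of_comp_g ((pullback.fst _ _).comp (component.incl _ _))
    (pullback.fst_comp_lift _ _ (A.1.comm.trans B.1.comm.symm))

theorem le_join_right (hY : Y.Connected) (hf : f.IsCovering) (A B : Intermediate f u) :
    Le B (join hY hf A B) :=
  le_of_comp_g ((pullback.snd _ _).comp (component.incl _ _))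
    (pullback.snd_comp_lift _ _ (A.1.comm.trans B.1.comm.symm))

theorem join_le (hY : Y.Connected) (hf : f.IsCovering) {A B C : Intermediate f u} :
    Le A C → Le B C → Le (join hY hf A B) C := by
  rintro ⟨s, -, h1, h2⟩ ⟨t, -, k1, k2⟩
  let l := pullback.lift s t (h2.trans k2.symm)
  have hl : l.comp C.1.g = pullback.lift A.1.g B.1.g (A.1.comm.trans B.1.comm.symm) := by
    apply pullback.hom_ext
    · rw [pullback.fst_comp_lift, ← h1]
      exact congrArg (fun k => Hom.comp k C.1.g) (pullback.fst_comp_lift s t (h2.trans k2.symm))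
    · rw [pullback.snd_comp_lift, ← k1]
      exact congrArg (fun k => Hom.comp k C.1.g) (pullback.snd_comp_lift s t (h2.trans k2.symm))
  -- The induced map respects base points, so the connected complex `C.Z` lands in the chosen
  -- component.
  have hp : l.vert C.1.pt = ⟨(A.1.pt, B.1.pt), A.1.h_pt.trans B.1.h_pt.symm⟩ := by
    rw [← C.1.g_pt]
    exact (congrArg (fun k : Hom Y _ => k.vert u) hl).trans
      (Subtype.ext (Prod.ext A.1.g_pt B.1.g_pt))
  exact le_of_comp_g (component.restrict C.2.connected l C.1.pt _ hp) (component.hom_ext hl)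

theorem meet_le_left (hf : f.IsCovering) (A B : Intermediate f u) :
    Le (meet hf A B) A :=
  le_of_comp_g (pushout.inl _) rfl

theorem meet_le_right (hf : f.IsCovering) (A B : Intermediate f u) :
    Le (meet hf A B) B :=
  le_of_comp_g (pushout.inr _) (pushout.condition _).symm

theorem le_meet (hf : f.IsCovering) {A B C : Intermediate f u} :
    Le C A → Le C B → Le C (meet hf A B) := by
  rintro ⟨s, -, h1, h2⟩ ⟨t, -, k1, k2⟩
  obtain ⟨r, hr⟩ := pushout.exists_lift (A.1.comm.trans B.1.comm.symm) C.1.h s t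
    (h1.trans k1.symm) h2 k2
  exact le_of_comp_g r (Eq.trans (congrArg (fun k => Hom.comp k A.1.g) hr) h1)

end Intermediate

/-! ### The lattice of equivalence classes. -/

namespace CoveringPoset

variable {Y X : TwoComplex.{u}} {f : Hom Y X} {u : Y.V}

/-- The lattice of intermediate coverings, with pullbacks as joins and pushouts as meets. -/
@[reducible]
noncomputable def lattice (hY : Y.Connected) (hf : f.IsCovering) : Lattice (CoveringPoset f u) where
  le := Le
  le_refl := by
    rintro ⟨A⟩
    exact Intermediate.le_of_comp_g (A := A) (B := A) (Hom.id _) rfl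
  le_trans := by
    rintro ⟨A⟩ ⟨B⟩ ⟨C⟩
    exact Intermediate.Le.trans
  le_antisymm := by
    rintro ⟨A⟩ ⟨B⟩ h h'
    exact Quotient.sound (Intermediate.Le.antisymm h h')
  -- Independence of representatives: equivalent pairs have the same upper bounds, so each join lies
  -- below the other and antisymmetry applies. Meets are dual.
  sup := Quotient.map₂ (Intermediate.join hY hf) fun A A' hA B B' hB =>
    Intermediate.Le.antisymm
      (Intermediate.join_le hY hf
        ((Intermediate.Equivalent.le hA.symm).trans (Intermediate.le_join_left hY hf A' B'))
        ((Intermediate.Equivalent.le hB.symm).trans (Intermediate.le_join_right hY hf A' B')))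
      (Intermediate.join_le hY hf
        ((Intermediate.Equivalent.le hA).trans (Intermediate.le_join_left hY hf A B))
        ((Intermediate.Equivalent.le hB).trans (Intermediate.le_join_right hY hf A B)))
  inf := Quotient.map₂ (Intermediate.meet hf) fun A A' hA B B' hB =>
    Intermediate.Le.antisymm
      (Intermediate.le_meet hf
        ((Intermediate.meet_le_left hf A B).trans (Intermediate.Equivalent.le hA.symm))
        ((Intermediate.meet_le_right hf A B).trans (Intermediate.Equivalent.le hB.symm)))
      (Intermediate.le_meet hf
        ((Intermediate.meet_le_left hf A' B').trans (Intermediate.Equivalent.le hA))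
        ((Intermediate.meet_le_right hf A' B').trans (Intermediate.Equivalent.le hB)))
  le_sup_left := by
    rintro ⟨A⟩ ⟨B⟩
    exact Intermediate.le_join_left hY hf A B
  le_sup_right := by
    rintro ⟨A⟩ ⟨B⟩
    exact Intermediate.le_join_right hY hf A B
  sup_le := by
    rintro ⟨A⟩ ⟨B⟩ ⟨C⟩
    exact Intermediate.join_le hY hf
  inf_le_left := by
    rintro ⟨A⟩ ⟨B⟩
    exact Intermediate.meet_le_left hf A B
  inf_le_right := by
    rintro ⟨A⟩ ⟨B⟩
    exact Intermediate.meet_le_right hf A B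
  le_inf := by
    rintro ⟨A⟩ ⟨B⟩ ⟨C⟩
    exact Intermediate.le_meet hf

end CoveringPoset

end TwoComplex

theorem mainTheorem2 {Y X : TwoComplex.{u}} (hY : Y.Connected) (hX : X.Connected)
    (f : TwoComplex.Hom Y X) (hf : f.IsCovering) (u : Y.V) :
    ∃ L : Lattice (TwoComplex.CoveringPoset f u),
      (∀ a b, L.le a b ↔ TwoComplex.CoveringPoset.Le a b) ∧
      (∀ (A B : TwoComplex.Factorisation f u) (hA : A.IsIntermediateCovering)
        (hB : B.IsIntermediateCovering),
        (∃ hP : (TwoComplex.Factorisation.pullback hY A B).IsIntermediateCovering,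
          L.sup (TwoComplex.CoveringPoset.mk A hA) (TwoComplex.CoveringPoset.mk B hB) =
            TwoComplex.CoveringPoset.mk _ hP) ∧
        (∃ hP : (TwoComplex.Factorisation.pushout A B).IsIntermediateCovering,
          L.inf (TwoComplex.CoveringPoset.mk A hA) (TwoComplex.CoveringPoset.mk B hB) =
            TwoComplex.CoveringPoset.mk _ hP)) ∧
      (∃ h0 : (TwoComplex.Factorisation.bottom f u).IsIntermediateCovering,
        ∀ a, TwoComplex.CoveringPoset.Le (TwoComplex.CoveringPoset.mk _ h0) a) ∧
      (∃ h1 : (TwoComplex.Factorisation.top f u).IsIntermediateCovering,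
        ∀ a, TwoComplex.CoveringPoset.Le a (TwoComplex.CoveringPoset.mk _ h1)) := by
  -- Joins and meets of classes compute on representatives to the pullback and pushout, whence the
  -- `rfl`s. The maps witnessing the extreme elements are the two factors `A.h` and `A.g` of `f`.
  refine ⟨TwoComplex.CoveringPoset.lattice hY hf, fun _ _ => Iff.rfl, fun A B hA hB =>
    ⟨⟨TwoComplex.Factorisation.pullback_isIntermediateCovering hY hf hA hB, rfl⟩,
      ⟨TwoComplex.Factorisation.pushout_isIntermediateCovering hf hA hB, rfl⟩⟩,
    ⟨TwoComplex.Factorisation.bottom_isIntermediateCovering hX hf, ?_⟩,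
    ⟨TwoComplex.Factorisation.top_isIntermediateCovering hY hf, ?_⟩⟩
  · rintro ⟨A⟩
    exact TwoComplex.Intermediate.le_of_comp_g (B := A) A.1.h A.1.comm
  · rintro ⟨A⟩
    exact TwoComplex.Intermediate.le_of_comp_g (A := A) A.1.g rfl
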